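/- Graphs are finite, undirected and may have parallel edges. A linear arrangement of $G=(V,E)$ with $n=|V|$ is a bijection $\pi:V\to\{1,\dots,n\}$; its cost is $\mathrm{COST}_\pi(G)=\sum_{e=\{u,v\}\in E}|\pi(u)-\pi(v)|$, and it is optimal if its cost is minimum. A two-terminal graph is a graph with two distinct distinguished vertices, its source and its sink (its terminals). The series composition of two-terminal graphs $X_1,\dots,X_k$ ($k\ge 2$) is their disjoint union in which the sink of $X_i$ is merged with the source of $X_{i+1}$ for $1\le i<k$; its source is that of $X_1$ and its sink is that of $X_k$. The parallel composition is the disjoint union in which all sources are merged into the new source and all sinks into the new sink. $G$ is series-parallel if, for some choice of two distinct vertices as terminals, it arises from single-edge two-terminal graphs by series and parallel compositions. An SP-tree of $G$ is a rooted tree whose nodes correspond to two-terminal subgraphs of $G$, with the root corresponding to $G$ (with some choice of terminals). Each leaf $L(k)$ corresponds to a path with $k\geq 1$ edges whose ends are the terminals; each inner node is an $S$-node or a $P$-node, whose graph is the series composition (in the order of the children), respectively the parallel composition, of the graphs of its at least two children. It is minimal if all children of an $S$-node are $P$-nodes or leaves and at least one is a $P$-node, and all children of a $P$-node are $S$-nodes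 or leaves. Given a minimal SP-tree of $G$, the algorithm SPGAA arranges the vertices of the graph of every node, from the leaves to the root, as follows (from left to right). - Leaf with path $v_1,\dots,v_k$ from source to sink: $v_1,v_k,v_2,v_{k-1},v_3,\dots$ - $P$-node with source $u$ and sink $v$: first $u$, then $v$, then one after another the arrangements computed for the children, with $u$ and $v$ deleted; the children are taken in any order in which a child with the largest number of vertices comes last. - $S$-node with source $u$, sink $v$ and children $P_1,\dots,P_m$: let $P_a$ be a child with the largest number of vertices, and let $B_i$ be the arrangement computed for $P_i$ with the sink of $P_i$ deleted, and for $i=1$ also with $u$ deleted. The arrangement is $u,\,v,\,B_1,\dots,B_{a-1},\,\overline{B_m},\overline{B_{m-1}},\dots,\overline{B_{a+1}},\,B_a$, where $\overline{B}$ is $B$ in reverse order. The arrangement computed for the root is denoted $\pi_{ALG}$. Ties, and the order of the other children of a $P$-node, may be resolved arbitrarily. Theorem. Let $G$ be a series-parallel graph with maximum degree $D$ (parallel edges counted separately). Then $G$ has a minimal SP-tree, and on every minimal SP-tree of $G$ the SPGAA computes an arrangement. Moreover, for every minimal SP-tree of $G$, every arrangement $\pi_{ALG}$ that the SPGAA can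 compute on it is a linear arrangement of $G$, and for every optimal linear arrangement $\pi_{OPT}$ of $G$, $$\mathrm{COST}_{\pi_{ALG}}(G)\le 14\cdot D^2\cdot \mathrm{COST}_{\pi_{OPT}}(G).$$ -/

import Mathlib

/-!
Series-parallel graphs, minimal SP-trees, the series-parallel graph arrangement algorithm (SPGAA)
and the cost of linear arrangements.

Graphs are the finite undirected multigraphs of Mathlib (`Graph α β`), since a parallel composition
of two single edges has two parallel edges; simple graphs are a special case.
-/

namespace SPG

variable {α β : Type*}

/-! ### Linear arrangements and their cost -/

/-- A linear arrangement of `G`: a one-to-one map from the `n` vertices of `G` onto `{1, …, n}`. -/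
def IsLinearArrangement (G : Graph α β) (π : α → ℕ) : Prop :=
  Set.BijOn π G.vertexSet (Set.Icc 1 G.vertexSet.ncard)

open Classical in
/-- The length `|π x - π y|` of an edge `e` with ends `x`, `y` (and `0` if `e` is not an edge). -/
noncomputable def edgeLength (G : Graph α β) (π : α → ℕ) (e : β) : ℕ :=
  if h : ∃ p : α × α, G.IsLink e p.1 p.2 then
    ((π h.choose.1 : ℤ) - (π h.choose.2 : ℤ)).natAbs
  else 0

/-- The length of an edge does not depend on the order in which its ends are listed. -/
theorem edgeLength_eq {G : Graph α β} {e : β} {x y : α} (π : α → ℕ) (h : G.IsLink e x y) :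
    edgeLength G π e = ((π x : ℤ) - (π y : ℤ)).natAbs := by
  have hex : ∃ p : α × α, G.IsLink e p.1 p.2 := ⟨(x, y), h⟩
  have hs := hex.choose_spec
  unfold edgeLength
  rw [dif_pos hex]
  rcases h.eq_and_eq_or_eq_and_eq hs with ⟨h1, h2⟩ | ⟨h1, h2⟩
  · rw [← h1, ← h2]
  · rw [← h1, ← h2]
    omega

/-- The cost of an arrangement: the sum of the lengths of all edges. -/
noncomputable def cost (G : Graph α β) (π : α → ℕ) : ℕ :=
  ∑ᶠ e ∈ G.edgeSet, edgeLength G π e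

/-- A linear arrangement of minimum cost. -/
def IsOptimalArrangement (G : Graph α β) (π : α → ℕ) : Prop :=
  IsLinearArrangement G π ∧ ∀ π' : α → ℕ, IsLinearArrangement G π' → cost G π ≤ cost G π'

/-- The maximum degree of a (finite, loopless) graph; the degree of a vertex is the number of
edges incident with it. -/
noncomputable def maxDegree (G : Graph α β) : ℕ :=
  sSup ((fun v => (G.incidenceSet v).ncard) '' G.vertexSet)

/-! ### Two-terminal graphs and their compositions -/

/-- A two-terminal graph. -/
structure TTG (α β : Type*) where
  graph : Graph α β
  source : α
  sink : α
  source_mem : source ∈ graph.vertexSet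
  sink_mem : sink ∈ graph.vertexSet
  source_ne_sink : source ≠ sink

/-- The number of vertices of a two-terminal graph. -/
noncomputable def TTG.card (X : TTG α β) : ℕ := X.graph.vertexSet.ncard

/-- `Y` is the union of the graphs `X i`, which have pairwise disjoint edge sets. -/
structure IsEdgeDisjointUnion {m : ℕ} (X : Fin m → TTG α β) (Y : TTG α β) : Prop where
  vertexSet_eq : Y.graph.vertexSet = ⋃ i, (X i).graph.vertexSet
  isLink_iff : ∀ e x y, Y.graph.IsLink e x y ↔ ∃ i, (X i).graph.IsLink e x y
  edge_disjoint : ∀ i j, i ≠ j → Disjoint (X i).graph.edgeSet (X j).graph.edgeSet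

/-- `Y` is the series composition of its two-terminal subgraphs `X 0, …, X (m - 1)`, `m ≥ 2`, in
this order. The sink of each `X i` is the source of `X (i + 1)` (the merged vertex), and apart from
these merged vertices the parts are disjoint. -/
structure IsSeriesComposition {m : ℕ} (X : Fin m → TTG α β) (Y : TTG α β) : Prop where
  two_le : 2 ≤ m
  union : IsEdgeDisjointUnion X Y
  sink_eq_source : ∀ i j : Fin m, (i : ℕ) + 1 = j → (X i).sink = (X j).source
  vertex_disjoint : ∀ i j : Fin m, i < j →
    ∀ v ∈ (X i).graph.vertexSet, v ∈ (X j).graph.vertexSet → (i : ℕ) + 1 = j ∧ v = (X i).sink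
  source_eq : ∀ i : Fin m, (i : ℕ) = 0 → Y.source = (X i).source
  sink_eq : ∀ i : Fin m, (i : ℕ) + 1 = m → Y.sink = (X i).sink

/-- `Y` is the parallel composition of its two-terminal subgraphs `X 0, …, X (m - 1)`, `m ≥ 2`.
All sources are merged, all sinks are merged, and apart from that the parts are disjoint. -/
structure IsParallelComposition {m : ℕ} (X : Fin m → TTG α β) (Y : TTG α β) : Prop where
  two_le : 2 ≤ m
  union : IsEdgeDisjointUnion X Y
  source_eq : ∀ i, (X i).source = Y.source
  sink_eq : ∀ i, (X i).sink = Y.sink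
  vertex_disjoint : ∀ i j : Fin m, i ≠ j →
    ∀ v ∈ (X i).graph.vertexSet, v ∈ (X j).graph.vertexSet → v = Y.source ∨ v = Y.sink

/-- Two-terminal series-parallel graphs: those built from single edges by series and parallel
compositions. -/
inductive IsTTSPG : TTG α β → Prop
  | edge (X : TTG α β) (e : β) (h : X.graph = Graph.banana X.source X.sink {e}) : IsTTSPG X
  | series {m : ℕ} (X : Fin m → TTG α β) (Y : TTG α β) (hX : ∀ i, IsTTSPG (X i))
      (h : IsSeriesComposition X Y) : IsTTSPG Y
  | parallel {m : ℕ} (X : Fin m → TTG α β) (Y : TTG α β) (hX : ∀ i, IsTTSPG (X i))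
      (h : IsParallelComposition X Y) : IsTTSPG Y

/-- `G` is series-parallel: for some choice of two distinct terminals it is a two-terminal
series-parallel graph. -/
def IsSeriesParallel (G : Graph α β) : Prop := ∃ X : TTG α β, X.graph = G ∧ IsTTSPG X

/-- `X` is a path from its source to its sink that runs through the vertices `v 0, …, v k` and the
edges `e 0, …, e (k - 1)`, in this order. -/
structure IsPathAlong (X : TTG α β) {k : ℕ} (v : Fin (k + 1) → α) (e : Fin k → β) : Prop where
  vertex_injective : Function.Injective v
  edge_injective : Function.Injective e
  vertexSet_eq : X.graph.vertexSet = Set.range v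
  isLink_iff : ∀ f x y, X.graph.IsLink f x y ↔ ∃ i : Fin k, f = e i ∧
    ((x = v i.castSucc ∧ y = v i.succ) ∨ (x = v i.succ ∧ y = v i.castSucc))
  source_eq : X.source = v 0
  sink_eq : X.sink = v (Fin.last k)

/-! ### SP-trees -/

/-- Rooted ordered trees with leaves labelled `L(k)` and with inner `S`-nodes and `P`-nodes, in
which a two-terminal graph is attached to every node. -/
inductive SPTree (α β : Type*)
  | leaf (k : ℕ) (X : TTG α β)
  | series (X : TTG α β) {m : ℕ} (child : Fin m → SPTree α β)
  | parallel (X : TTG α β) {m : ℕ} (child : Fin m → SPTree α β)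

namespace SPTree

/-- The two-terminal graph that corresponds to the root. -/
def ttg : SPTree α β → TTG α β
  | leaf _ X => X
  | series X _ => X
  | parallel X _ => X

/-- The root is a leaf (an `L`-node). -/
def IsL : SPTree α β → Prop
  | leaf _ _ => True
  | series _ _ => False
  | parallel _ _ => False

/-- The root is an `S`-node. -/
def IsS : SPTree α β → Prop
  | leaf _ _ => False
  | series _ _ => True
  | parallel _ _ => False

/-- The root is a `P`-node. -/
def IsP : SPTree α β → Prop
  | leaf _ _ => False
  | series _ _ => False
  | parallel _ _ => True

/-- The tree is an SP-tree of the two-terminal graph attached to its root: every leaf `L(k)`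
corresponds to a path with `k` edges, and the graph of every `S`-node (`P`-node) is the series
(parallel) composition of the graphs of its children. -/
def IsSPTree : SPTree α β → Prop
  | leaf k X => ∃ (v : Fin (k + 1) → α) (e : Fin k → β), IsPathAlong X v e
  | series X child => IsSeriesComposition (fun i => (child i).ttg) X ∧ ∀ i, (child i).IsSPTree
  | parallel X child => IsParallelComposition (fun i => (child i).ttg) X ∧ ∀ i, (child i).IsSPTree

/-- Minimality: all children of an `S`-node are `P`- or `L`-nodes and at least one of them is a
`P`-node; all children of a `P`-node are `S`- or `L`-nodes. -/
def IsMinimal : SPTree α β → Prop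
  | leaf _ _ => True
  | series _ child =>
      (∀ i, (child i).IsP ∨ (child i).IsL) ∧ (∃ i, (child i).IsP) ∧ ∀ i, (child i).IsMinimal
  | parallel _ child => (∀ i, (child i).IsS ∨ (child i).IsL) ∧ ∀ i, (child i).IsMinimal

/-- `T` is a minimal SP-tree of the graph `G`. -/
def IsMinimalSPTreeOf (T : SPTree α β) (G : Graph α β) : Prop :=
  T.ttg.graph = G ∧ T.IsSPTree ∧ T.IsMinimal

end SPTree

/-! ### The arrangement algorithm

Arrangements computed by the algorithm are written as the list of the vertices from left to right.
-/

/-- Rearranges `1, 2, …, k` into `1, k, 2, k - 1, 3, k - 2, …`. -/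
def zigzag : List α → List α
  | [] => []
  | a :: l => a :: zigzag l.reverse
termination_by l => l.length
decreasing_by simp

/-- The arrangement of a parallel component with source `u` and sink `v`: first `u`, then `v`, then
the arrangements `l i` of the child components without their terminals, in the given order. -/
def parallelLayout [DecidableEq α] (u v : α) {m : ℕ} (l : Fin m → List α)
    (order : List (Fin m)) : List α :=
  u :: v :: order.flatMap fun i => (l i).filter fun x => x ≠ u ∧ x ≠ v

/-- The order in which a series component with source `u` and sink `v` places its child components,
where `l i` is the arrangement of the `i`-th child, `t i` is its sink, and the `a`-th child is a
biggest one: first `u`, then `v`, then the children before `a` in order, then the children after `a`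
in reverse order, each one flipped, and finally the child `a`. Every child is placed without its
sink, and the first child also without its source `u`. -/
def seriesLayout [DecidableEq α] (u v : α) {m : ℕ} (l : Fin m → List α) (t : Fin m → α)
    (a : Fin m) : List α :=
  let block : Fin m → List α := fun i => (l i).filter fun x => x ≠ t i ∧ x ≠ u
  u :: v :: (((List.finRange m).filter fun i => i < a).flatMap block ++
    ((List.finRange m).filter fun i => a < i).reverse.flatMap (fun i => (block i).reverse) ++
    block a)

/-- `SPGAA T l`: on the SP-tree `T` the algorithm may compute the arrangement `l`. The algorithm is
free to choose which biggest child component it places last, and to choose the order of the other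
child components of a parallel component. -/
inductive SPGAA [DecidableEq α] : SPTree α β → List α → Prop
  | leaf {k : ℕ} (X : TTG α β) (v : Fin (k + 1) → α) (e : Fin k → β) (h : IsPathAlong X v e) :
      SPGAA (SPTree.leaf k X) (zigzag (List.ofFn v))
  | series (X : TTG α β) {m : ℕ} (child : Fin m → SPTree α β) (l : Fin m → List α)
      (hl : ∀ i, SPGAA (child i) (l i))
      (a : Fin m) (ha : ∀ i, (child i).ttg.card ≤ (child a).ttg.card) :
      SPGAA (SPTree.series X child)
        (seriesLayout X.source X.sink l (fun i => (child i).ttg.sink) a)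
  | parallel (X : TTG α β) {m : ℕ} (child : Fin m → SPTree α β) (l : Fin m → List α)
      (hl : ∀ i, SPGAA (child i) (l i))
      (a : Fin m) (ha : ∀ i, (child i).ttg.card ≤ (child a).ttg.card)
      (others : List (Fin m)) (horder : (others ++ [a]).Perm (List.finRange m)) :
      SPGAA (SPTree.parallel X child) (parallelLayout X.source X.sink l (others ++ [a]))

/-- The position (counted from `1`) of a vertex in an arrangement given as a list. -/
def position [DecidableEq α] (l : List α) (x : α) : ℕ := l.idxOf x + 1

end SPG

/-! Both costs are compared with one quantity, the load Λ of the tree: the sum over all inner nodes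
of the number of vertices outside a biggest child.

Upper bound (`SPGAA.sum_edgeLength_le`): the cost of the computed arrangement is at most 2|E| + 4DΛ.
On a leaf the zigzag order stretches each edge to length at most 2. Every computed arrangement
starts with source and sink, and an inner node puts the blocks of its children side by side,
possibly flipped. So only edges at a terminal of a child can become longer, and there are at most D
of them per terminal. Since the biggest child is placed last, the total growth at a node is at most
4D times the number of vertices outside that child.

Lower bound (`load_le`): for a linear arrangement π, the cost is at least |E| plus the number of
crossings, that is, pairs of an edge and a vertex strictly below it. If a child has vertices on both
sides of a vertex z that is not its own, then z is covered; by connectivity an edge of the child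
passes over z, and this crossing is counted inside no child. So the crossings of a node exceed those
of its children by at least the number of covered vertices (`sum_crossings_add_le`). Vertices
outside a biggest child that are not covered are paid for by a potential. Let L, R and M be the sets
of vertices left of, right of and between the two terminals; the potential is min(|L|,|R|), plus |M|
at an S-node. The count `add_sum_min_card_le` compares the child with the leftmost vertex and the
child with the rightmost one: if they agree, that child covers what is outside it; otherwise every
other child has a covered left or right side. At a P-node the vertices of M are covered by any other
child, so |M| is needed only at S-nodes. Minimality makes the two kinds alternate, which closes the
induction.

At the root the potential is at most |V| - 2 ≤ |E| - 1, hence Λ ≤ 3·COST(π), and 2 + 12D ≤ 14D²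
finishes the proof.

Existence of a minimal tree is associativity of both compositions: nested S-nodes, nested P-nodes
and series of paths are flattened. -/

namespace SPG

variable {α β : Type*}

/-! ### Flattening nested compositions -/

section SigmaIndex

variable {m : ℕ} {n : Fin m → ℕ}

/-- The total size of the first `i` blocks. -/
def blockStart (n : Fin m → ℕ) (i : ℕ) : ℕ :=
  ∑ j ∈ Finset.range i, if h : j < m then n ⟨j, h⟩ else 0

theorem blockStart_succ (i : Fin m) : blockStart n (i + 1) = blockStart n i + n i := by
  simp [blockStart, Finset.sum_range_succ]

theorem blockStart_mono : Monotone (blockStart n) := fun _ _ h =>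
  Finset.sum_le_sum_of_subset (Finset.range_mono h)

theorem blockStart_last : blockStart n m = ∑ i, n i := by
  rw [blockStart, ← Fin.sum_univ_eq_sum_range (fun j => if h : j < m then n ⟨j, h⟩ else 0) m]
  simp

theorem finSigmaFinEquiv_val (i : Fin m) (k : Fin (n i)) :
    (finSigmaFinEquiv ⟨i, k⟩ : ℕ) = blockStart n i + k := by
  rw [finSigmaFinEquiv_apply, blockStart,
    ← Fin.sum_univ_eq_sum_range (fun j => if h : j < m then n ⟨j, h⟩ else 0) i]
  congr 1
  refine Finset.sum_congr rfl fun j _ => ?_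
  rw [dif_pos (j.2.trans i.2)]
  rfl

theorem finSigmaFinEquiv_lt {i j : Fin m} {k : Fin (n i)} {l : Fin (n j)}
    (h : finSigmaFinEquiv ⟨i, k⟩ < finSigmaFinEquiv ⟨j, l⟩) : i < j ∨ i = j ∧ (k : ℕ) < l := by
  rw [Fin.lt_def, finSigmaFinEquiv_val, finSigmaFinEquiv_val] at h
  rcases lt_trichotomy i j with hij | rfl | hij
  · exact Or.inl hij
  · exact Or.inr ⟨rfl, by omega⟩
  · have := blockStart_mono (n := n) (Nat.succ_le_of_lt (Fin.lt_def.mp hij))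
    have h2 := blockStart_succ (n := n) j
    have := l.2
    simp only [Nat.succ_eq_add_one] at *
    omega

/-- The numbering of the pairs is lexicographic. Nonemptiness of the blocks is what forces the
successor of a last entry to lie in the very next block. -/
theorem finSigmaFinEquiv_succ (hn : ∀ i, 0 < n i) {i j : Fin m} {k : Fin (n i)} {l : Fin (n j)} :
    (finSigmaFinEquiv ⟨i, k⟩ : ℕ) + 1 = finSigmaFinEquiv ⟨j, l⟩ ↔
      (i = j ∧ (k : ℕ) + 1 = l) ∨ ((i : ℕ) + 1 = j ∧ (k : ℕ) + 1 = n i ∧ (l : ℕ) = 0) := by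
  rw [finSigmaFinEquiv_val, finSigmaFinEquiv_val]
  have hk := k.2
  have hl := l.2
  have hi := blockStart_succ (n := n) i
  have hj := blockStart_succ (n := n) j
  constructor
  · intro h
    rcases lt_trichotomy i j with hij | rfl | hij
    · have h1 := blockStart_mono (n := n) (Nat.succ_le_of_lt (Fin.lt_def.mp hij))
      simp only [Nat.succ_eq_add_one] at h1
      refine Or.inr ⟨?_, by omega, by omega⟩
      by_contra hne
      have hlt : (i : ℕ) + 1 < j := by have := Fin.lt_def.mp hij; omega
      have h2 := blockStart_mono (n := n) (Nat.succ_le_of_lt hlt)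
      have h3 := blockStart_succ (n := n) ⟨i + 1, by omega⟩
      have h4 := hn ⟨i + 1, by omega⟩
      simp only [Nat.succ_eq_add_one] at *
      omega
    · exact Or.inl ⟨rfl, by omega⟩
    · have h1 := blockStart_mono (n := n) (Nat.succ_le_of_lt (Fin.lt_def.mp hij))
      simp only [Nat.succ_eq_add_one] at h1
      omega
  · rintro (⟨rfl, h⟩ | ⟨h1, h2, h3⟩)
    · omega
    · rw [← h1]
      omega

theorem finSigmaFinEquiv_eq_zero (hn : ∀ i, 0 < n i) {i : Fin m} {k : Fin (n i)}
    (h : (finSigmaFinEquiv ⟨i, k⟩ : ℕ) = 0) : (i : ℕ) = 0 ∧ (k : ℕ) = 0 := by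
  rw [finSigmaFinEquiv_val] at h
  refine ⟨?_, by omega⟩
  by_contra hi
  have h1 := blockStart_mono (n := n) (show 0 + 1 ≤ (i : ℕ) by omega)
  have h2 := blockStart_succ (n := n) ⟨0, by omega⟩
  have h3 := hn ⟨0, by omega⟩
  simp only at *
  omega

theorem finSigmaFinEquiv_eq_last (hn : ∀ i, 0 < n i) {i : Fin m} {k : Fin (n i)}
    (h : (finSigmaFinEquiv ⟨i, k⟩ : ℕ) + 1 = ∑ i, n i) : (i : ℕ) + 1 = m ∧ (k : ℕ) + 1 = n i := by
  rw [finSigmaFinEquiv_val, ← blockStart_last] at h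
  have hk := k.2
  have h0 := blockStart_succ (n := n) i
  have h1 := blockStart_mono (n := n) (show (i : ℕ) + 1 ≤ m from i.2)
  refine ⟨?_, by omega⟩
  by_contra hi
  have h2 := blockStart_mono (n := n) (show (i : ℕ) + 1 + 1 ≤ m by omega)
  have h3 := blockStart_succ (n := n) ⟨i + 1, by omega⟩
  have h4 := hn ⟨i + 1, by omega⟩
  simp only at *
  omega

theorem exists_finSigma_iff (p : ∀ i, Fin (n i) → Prop) :
    (∃ q, p (finSigmaFinEquiv.symm q).1 (finSigmaFinEquiv.symm q).2) ↔ ∃ i k, p i k := by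
  constructor
  · rintro ⟨q, hq⟩
    exact ⟨_, _, hq⟩
  · rintro ⟨i, k, h⟩
    exact ⟨finSigmaFinEquiv ⟨i, k⟩, by rwa [Equiv.symm_apply_apply]⟩

end SigmaIndex

/-- The union of a nested family of unions. -/
theorem IsEdgeDisjointUnion.flatten {m : ℕ} {X : Fin m → TTG α β} {Y : TTG α β}
    (h : IsEdgeDisjointUnion X Y) {n : Fin m → ℕ} {Z : ∀ i, Fin (n i) → TTG α β}
    (hZ : ∀ i, IsEdgeDisjointUnion (Z i) (X i)) :
    IsEdgeDisjointUnion
      (fun q => Z (finSigmaFinEquiv.symm q).1 (finSigmaFinEquiv.symm q).2) Y where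
  vertexSet_eq := by
    rw [h.vertexSet_eq]
    ext x
    simp only [Set.mem_iUnion, (hZ _).vertexSet_eq]
    exact (exists_finSigma_iff fun i k => x ∈ (Z i k).graph.vertexSet).symm
  isLink_iff e x y := by
    rw [h.isLink_iff, exists_finSigma_iff fun i k => (Z i k).graph.IsLink e x y]
    simp only [(hZ _).isLink_iff]
  edge_disjoint p q hpq := by
    obtain ⟨⟨i, k⟩, rfl⟩ := finSigmaFinEquiv.surjective p
    obtain ⟨⟨j, l⟩, rfl⟩ := finSigmaFinEquiv.surjective q
    rw [Equiv.symm_apply_apply, Equiv.symm_apply_apply]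
    have hsub : ∀ i k, (Z i k).graph.edgeSet ⊆ (X i).graph.edgeSet := by
      intro i k e he
      obtain ⟨x, y, hxy⟩ := Graph.exists_isLink_of_mem_edgeSet he
      exact (((hZ i).isLink_iff e x y).2 ⟨k, hxy⟩).edge_mem
    by_cases hij : i = j
    · subst hij
      exact (hZ i).edge_disjoint k l (by rintro rfl; exact hpq rfl)
    · exact (h.edge_disjoint i j hij).mono (hsub i k) (hsub j l)

/-- A series composition of at least one two-terminal graph. -/
structure IsChain {m : ℕ} (X : Fin m → TTG α β) (Y : TTG α β) : Prop where
  pos : 0 < m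
  union : IsEdgeDisjointUnion X Y
  sink_eq_source : ∀ i j : Fin m, (i : ℕ) + 1 = j → (X i).sink = (X j).source
  vertex_disjoint : ∀ i j : Fin m, i < j →
    ∀ v ∈ (X i).graph.vertexSet, v ∈ (X j).graph.vertexSet → (i : ℕ) + 1 = j ∧ v = (X i).sink
  source_eq : ∀ i : Fin m, (i : ℕ) = 0 → Y.source = (X i).source
  sink_eq : ∀ i : Fin m, (i : ℕ) + 1 = m → Y.sink = (X i).sink

theorem IsSeriesComposition.isChain {m : ℕ} {X : Fin m → TTG α β} {Y : TTG α β}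
    (h : IsSeriesComposition X Y) : IsChain X Y :=
  ⟨by have := h.two_le; omega, h.union, h.sink_eq_source, h.vertex_disjoint, h.source_eq,
    h.sink_eq⟩

theorem IsChain.isSeriesComposition {m : ℕ} {X : Fin m → TTG α β} {Y : TTG α β}
    (h : IsChain X Y) (hm : 2 ≤ m) : IsSeriesComposition X Y :=
  ⟨hm, h.union, h.sink_eq_source, h.vertex_disjoint, h.source_eq, h.sink_eq⟩

theorem IsEdgeDisjointUnion.single (Y : TTG α β) :
    IsEdgeDisjointUnion (fun _ : Fin 1 => Y) Y where
  vertexSet_eq := (Set.iUnion_const Y.graph.vertexSet).symm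
  isLink_iff _ _ _ := ⟨fun h => ⟨0, h⟩, fun ⟨_, h⟩ => h⟩
  edge_disjoint i j hij := absurd (Subsingleton.elim i j) hij

theorem IsChain.single (Y : TTG α β) : IsChain (fun _ : Fin 1 => Y) Y where
  pos := one_pos
  union := .single Y
  sink_eq_source i j hij := by omega
  vertex_disjoint i j hij := by omega
  source_eq _ _ := rfl
  sink_eq _ _ := rfl

/-- Associativity of series composition. Since a chain may have a single part, blocks that must stay
whole can be flattened together with blocks that are split. -/
theorem IsChain.flatten {m : ℕ} {X : Fin m → TTG α β} {Y : TTG α β} (h : IsChain X Y)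
    {n : Fin m → ℕ} {Z : ∀ i, Fin (n i) → TTG α β} (hZ : ∀ i, IsChain (Z i) (X i)) :
    IsChain (fun q => Z (finSigmaFinEquiv.symm q).1 (finSigmaFinEquiv.symm q).2) Y where
  pos := Finset.sum_pos (fun i _ => (hZ i).pos) ⟨⟨0, h.pos⟩, Finset.mem_univ _⟩
  union := h.union.flatten fun i => (hZ i).union
  sink_eq_source p q hpq := by
    obtain ⟨⟨i, k⟩, rfl⟩ := finSigmaFinEquiv.surjective p
    obtain ⟨⟨j, l⟩, rfl⟩ := finSigmaFinEquiv.surjective q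
    rw [Equiv.symm_apply_apply, Equiv.symm_apply_apply]
    rcases (finSigmaFinEquiv_succ fun i => (hZ i).pos).1 hpq with ⟨rfl, h1⟩ | ⟨h1, h2, h3⟩
    · exact (hZ i).sink_eq_source k l h1
    · exact ((hZ i).sink_eq k h2).symm.trans
        ((h.sink_eq_source i j h1).trans ((hZ j).source_eq l h3))
  vertex_disjoint p q hpq v hv hv' := by
    obtain ⟨⟨i, k⟩, rfl⟩ := finSigmaFinEquiv.surjective p
    obtain ⟨⟨j, l⟩, rfl⟩ := finSigmaFinEquiv.surjective q
    rw [Equiv.symm_apply_apply] at hv hv' ⊢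
    rw [finSigmaFinEquiv_succ fun i => (hZ i).pos]
    rcases finSigmaFinEquiv_lt hpq with hij | ⟨rfl, hkl⟩
    · have hmem : ∀ i k, v ∈ (Z i k).graph.vertexSet → v ∈ (X i).graph.vertexSet := by
        intro i k hv
        rw [(hZ i).union.vertexSet_eq]
        exact Set.mem_iUnion_of_mem k hv
      obtain ⟨h1, h2⟩ := h.vertex_disjoint i j hij v (hmem i k hv) (hmem j l hv')
      -- The common vertex is the sink of block `i`, hence lies in the last part of that block. If
      -- part `k` were earlier, the vertex would be the sink of part `k` and so the source of the
      -- last part, whose terminals would coincide. The argument for `l` is symmetric.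
      have hk : (k : ℕ) + 1 = n i := by
        by_contra hk
        have hlast := (hZ i).sink_eq ⟨n i - 1, by omega⟩ (by dsimp only; omega)
        have h3 := (hZ i).vertex_disjoint k ⟨n i - 1, by omega⟩
          (Fin.lt_def.2 (by dsimp only; omega)) v hv
          (by rw [h2, hlast]; exact (Z i _).sink_mem)
        have h4 := (hZ i).sink_eq_source k ⟨n i - 1, by omega⟩ h3.1
        exact (Z i ⟨n i - 1, by omega⟩).source_ne_sink
          (h4.symm.trans (h3.2.symm.trans (h2.trans hlast)))
      have hl : (l : ℕ) = 0 := by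
        by_contra hl
        have hfirst := (hZ j).source_eq ⟨0, by omega⟩ rfl
        have h2' : v = (X j).source := h2.trans (h.sink_eq_source i j h1)
        have h3 := (hZ j).vertex_disjoint ⟨0, by omega⟩ l
          (Fin.lt_def.2 (by dsimp only; omega)) v
          (by rw [h2', hfirst]; exact (Z j _).source_mem) hv'
        exact (Z j ⟨0, by omega⟩).source_ne_sink (hfirst.symm.trans (h2'.symm.trans h3.2))
      exact ⟨Or.inr ⟨h1, hk, hl⟩, h2.trans ((hZ i).sink_eq k hk)⟩
    · obtain ⟨h1, h2⟩ := (hZ i).vertex_disjoint k l hkl v hv hv'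
      exact ⟨Or.inl ⟨rfl, h1⟩, h2⟩
  source_eq p hp := by
    obtain ⟨⟨i, k⟩, rfl⟩ := finSigmaFinEquiv.surjective p
    rw [Equiv.symm_apply_apply]
    obtain ⟨h1, h2⟩ := finSigmaFinEquiv_eq_zero (fun i => (hZ i).pos) hp
    exact (h.source_eq i h1).trans ((hZ i).source_eq k h2)
  sink_eq p hp := by
    obtain ⟨⟨i, k⟩, rfl⟩ := finSigmaFinEquiv.surjective p
    rw [Equiv.symm_apply_apply]
    obtain ⟨h1, h2⟩ := finSigmaFinEquiv_eq_last (fun i => (hZ i).pos) hp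
    exact (h.sink_eq i h1).trans ((hZ i).sink_eq k h2)

/-- A parallel composition of at least one two-terminal graph. -/
structure IsBundle {m : ℕ} (X : Fin m → TTG α β) (Y : TTG α β) : Prop where
  pos : 0 < m
  union : IsEdgeDisjointUnion X Y
  source_eq : ∀ i, (X i).source = Y.source
  sink_eq : ∀ i, (X i).sink = Y.sink
  vertex_disjoint : ∀ i j : Fin m, i ≠ j →
    ∀ v ∈ (X i).graph.vertexSet, v ∈ (X j).graph.vertexSet → v = Y.source ∨ v = Y.sink

theorem IsParallelComposition.isBundle {m : ℕ} {X : Fin m → TTG α β} {Y : TTG α β}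
    (h : IsParallelComposition X Y) : IsBundle X Y :=
  ⟨by have := h.two_le; omega, h.union, h.source_eq, h.sink_eq, h.vertex_disjoint⟩

theorem IsBundle.isParallelComposition {m : ℕ} {X : Fin m → TTG α β} {Y : TTG α β}
    (h : IsBundle X Y) (hm : 2 ≤ m) : IsParallelComposition X Y :=
  ⟨hm, h.union, h.source_eq, h.sink_eq, h.vertex_disjoint⟩

theorem IsBundle.single (Y : TTG α β) : IsBundle (fun _ : Fin 1 => Y) Y where
  pos := one_pos
  union := .single Y
  source_eq _ := rfl
  sink_eq _ := rfl
  vertex_disjoint i j hij := absurd (Subsingleton.elim i j) hij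

theorem IsBundle.flatten {m : ℕ} {X : Fin m → TTG α β} {Y : TTG α β} (h : IsBundle X Y)
    {n : Fin m → ℕ} {Z : ∀ i, Fin (n i) → TTG α β} (hZ : ∀ i, IsBundle (Z i) (X i)) :
    IsBundle (fun q => Z (finSigmaFinEquiv.symm q).1 (finSigmaFinEquiv.symm q).2) Y where
  pos := Finset.sum_pos (fun i _ => (hZ i).pos) ⟨⟨0, h.pos⟩, Finset.mem_univ _⟩
  union := h.union.flatten fun i => (hZ i).union
  source_eq p := ((hZ _).source_eq _).trans (h.source_eq _)
  sink_eq p := ((hZ _).sink_eq _).trans (h.sink_eq _)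
  vertex_disjoint p q hpq v hv hv' := by
    obtain ⟨⟨i, k⟩, rfl⟩ := finSigmaFinEquiv.surjective p
    obtain ⟨⟨j, l⟩, rfl⟩ := finSigmaFinEquiv.surjective q
    rw [Equiv.symm_apply_apply] at hv hv'
    by_cases hij : i = j
    · subst hij
      rw [← h.source_eq i, ← h.sink_eq i]
      exact (hZ i).vertex_disjoint k l (by rintro rfl; exact hpq rfl) v hv hv'
    · have hmem : ∀ i k, v ∈ (Z i k).graph.vertexSet → v ∈ (X i).graph.vertexSet := by
        intro i k hv
        rw [(hZ i).union.vertexSet_eq]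
        exact Set.mem_iUnion_of_mem k hv
      exact h.vertex_disjoint i j hij v (hmem i k hv) (hmem j l hv')

/-! ### Paths are chains of single edges -/

/-- A two-terminal graph that consists of one edge. -/
def IsSingleEdge (X : TTG α β) : Prop := ∃ e, X.graph = Graph.banana X.source X.sink {e}

/-- With the converse below, concatenation of paths becomes an instance of flattening chains. -/
theorem IsPathAlong.exists_chain {X : TTG α β} {k : ℕ} {v : Fin (k + 1) → α} {e : Fin k → β}
    (h : IsPathAlong X v e) : ∃ Z : Fin k → TTG α β, IsChain Z X ∧ ∀ i, IsSingleEdge (Z i) := by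
  have hk : 0 < k := by
    rcases Nat.eq_zero_or_pos k with rfl | hk
    · exact absurd (h.source_eq.trans h.sink_eq.symm) X.source_ne_sink
    · exact hk
  refine ⟨fun i => ⟨Graph.banana (v i.castSucc) (v i.succ) {e i}, v i.castSucc, v i.succ,
    by simp, by simp, fun hv => ?_⟩, ?_, fun i => ⟨e i, rfl⟩⟩
  · have := congrArg Fin.val (h.vertex_injective hv)
    simp at this
  · refine ⟨hk, ⟨?_, fun f x y => ?_, fun i j hij => ?_⟩, fun i j hij => ?_,
      fun i j hij x hx hx' => ?_, fun i hi => ?_, fun i hi => ?_⟩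
    · rw [h.vertexSet_eq]
      ext x
      simp only [Set.mem_range, Set.mem_iUnion, Graph.vertexSet_banana, Set.mem_insert_iff,
        Set.mem_singleton_iff]
      constructor
      · rintro ⟨j, rfl⟩
        rcases Fin.eq_castSucc_or_eq_last j with ⟨i, rfl⟩ | rfl
        · exact ⟨i, Or.inl rfl⟩
        · exact ⟨⟨k - 1, by omega⟩, Or.inr (congrArg v (Fin.ext (by simp; omega)))⟩
      · rintro ⟨i, rfl | rfl⟩
        · exact ⟨_, rfl⟩
        · exact ⟨_, rfl⟩
    · simp [h.isLink_iff]
    · simp only [Graph.edgeSet_banana, Set.disjoint_singleton]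
      exact fun he => hij (h.edge_injective he)
    · exact congrArg v (Fin.ext (by simpa using hij))
    · have hij' := Fin.lt_def.mp hij
      simp only [Graph.vertexSet_banana, Set.mem_insert_iff, Set.mem_singleton_iff] at hx hx'
      have key : i.succ = j.castSucc ∧ x = v i.succ := by
        rcases hx with rfl | rfl <;> rcases hx' with hx' | hx' <;>
          have := congrArg Fin.val (h.vertex_injective hx') <;>
          simp at this
        · omega
        · omega
        · exact ⟨Fin.ext (by simpa using this), rfl⟩
        · omega
      exact ⟨by simpa using congrArg Fin.val key.1, key.2⟩
    · exact h.source_eq.trans (congrArg v (Fin.ext (by simpa using hi.symm)))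
    · exact h.sink_eq.trans (congrArg v (Fin.ext (by simpa using hi.symm)))

theorem IsChain.exists_isPathAlong {X : TTG α β} {m : ℕ} {Z : Fin m → TTG α β}
    (h : IsChain Z X) (hZ : ∀ i, IsSingleEdge (Z i)) :
    ∃ (v : Fin (m + 1) → α) (e : Fin m → β), IsPathAlong X v e := by
  choose e he using hZ
  -- The sources of the edges in order, then the final sink; the sink of each edge is then the next
  -- entry.
  set v : Fin (m + 1) → α := Fin.snoc (α := fun _ => α) (fun i => (Z i).source) X.sink with hv
  have hv1 : ∀ i : Fin m, v i.castSucc = (Z i).source := fun i => by simp [hv]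
  have hv2 : v (Fin.last m) = X.sink := by simp [hv]
  have hv3 : ∀ i : Fin m, v i.succ = (Z i).sink := by
    intro i
    by_cases hi : (i : ℕ) + 1 = m
    · have : i.succ = Fin.last m := Fin.ext (by simpa using hi)
      rw [this, hv2, h.sink_eq i hi]
    · have : i.succ = Fin.castSucc ⟨i + 1, by omega⟩ := Fin.ext (by simp)
      rw [this, hv1, ← h.sink_eq_source i ⟨i + 1, by omega⟩ rfl]
  -- The earlier vertex is the source of some part and the later one the sink of the same or a later
  -- part. Two different parts meet only in the sink of the earlier one, so equality would identify
  -- the terminals of one part.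
  have hne : ∀ i j : Fin (m + 1), i < j → v i ≠ v j := by
    intro i j hij hvij
    obtain ⟨i, rfl⟩ : ∃ i' : Fin m, i'.castSucc = i :=
      ⟨⟨i, by have := Fin.lt_def.mp hij; omega⟩, rfl⟩
    obtain ⟨j, rfl⟩ : ∃ j' : Fin m, j'.succ = j :=
      ⟨⟨j - 1, by have := Fin.lt_def.mp hij; simp at this; omega⟩,
        Fin.ext (by have := Fin.lt_def.mp hij; simp at this ⊢; omega)⟩
    rw [hv1, hv3] at hvij
    rcases (show i ≤ j by rw [Fin.lt_def] at hij; simp at hij; rw [Fin.le_def]; omega).eq_or_lt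
      with rfl | hlt
    · exact (Z i).source_ne_sink hvij
    · exact (Z i).source_ne_sink
        (h.vertex_disjoint i j hlt _ (Z i).source_mem (by rw [hvij]; exact (Z j).sink_mem)).2
  refine ⟨v, e, ⟨?_, ?_, ?_, ?_, ?_, hv2.symm⟩⟩
  · intro i j hij
    rcases lt_trichotomy i j with hlt | heq | hlt
    · exact absurd hij (hne i j hlt)
    · exact heq
    · exact absurd hij.symm (hne j i hlt)
  · intro i j hij
    by_contra hne
    have := h.union.edge_disjoint i j hne
    rw [he i, he j] at this
    simp [hij] at this
  · rw [h.union.vertexSet_eq]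
    ext x
    simp only [Set.mem_range, Set.mem_iUnion]
    constructor
    · rintro ⟨i, hi⟩
      rw [he i] at hi
      simp only [Graph.vertexSet_banana, Set.mem_insert_iff, Set.mem_singleton_iff] at hi
      rcases hi with rfl | rfl
      · exact ⟨_, hv1 i⟩
      · exact ⟨_, hv3 i⟩
    · rintro ⟨j, rfl⟩
      rcases Fin.eq_castSucc_or_eq_last j with ⟨i, rfl⟩ | rfl
      · exact ⟨i, by rw [hv1]; exact (Z i).source_mem⟩
      · have hm := h.pos
        refine ⟨⟨m - 1, by omega⟩, ?_⟩
        rw [hv2, h.sink_eq ⟨m - 1, by omega⟩ (by dsimp only; omega)]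
        exact (Z _).sink_mem
  · intro f x y
    rw [h.union.isLink_iff]
    refine exists_congr fun i => ?_
    rw [he i, hv1, hv3]
    simp
  · rw [h.source_eq ⟨0, h.pos⟩ rfl, ← hv1]
    rfl

/-! ### Existence of minimal SP-trees -/

namespace SPTree

theorem exists_chain_of_isL {T : SPTree α β} (hT : T.IsSPTree) (hL : T.IsL) :
    ∃ (k : ℕ) (Z : Fin k → TTG α β), IsChain Z T.ttg ∧ ∀ i, IsSingleEdge (Z i) := by
  cases T with
  | leaf k X =>
    obtain ⟨v, e, h⟩ := hT
    exact ⟨k, h.exists_chain⟩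
  | series => exact hL.elim
  | parallel => exact hL.elim

/-- The children of an `S`-node, and the node itself if it is not an `S`-node. -/
theorem exists_series_parts {T : SPTree α β} (hT : T.IsSPTree) (hmin : T.IsMinimal) :
    ∃ (k : ℕ) (c : Fin k → SPTree α β), IsChain (fun i => (c i).ttg) T.ttg ∧
      (∀ i, (c i).IsSPTree) ∧ (∀ i, (c i).IsMinimal) ∧ (∀ i, (c i).IsP ∨ (c i).IsL) ∧
      (¬ T.IsL → ∃ i, (c i).IsP) := by
  cases T with
  | leaf k X =>
    exact ⟨1, fun _ => leaf k X, .single _, fun _ => hT, fun _ => hmin, fun _ => Or.inr trivial,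
      fun h => (h trivial).elim⟩
  | series X c =>
    exact ⟨_, c, hT.1.isChain, hT.2, hmin.2.2, hmin.1, fun _ => hmin.2.1⟩
  | parallel X c =>
    exact ⟨1, fun _ => parallel X c, .single _, fun _ => hT, fun _ => hmin,
      fun _ => Or.inl trivial, fun _ => ⟨0, trivial⟩⟩

/-- The children of a `P`-node, and the node itself if it is not a `P`-node. -/
theorem exists_parallel_parts {T : SPTree α β} (hT : T.IsSPTree) (hmin : T.IsMinimal) :
    ∃ (k : ℕ) (c : Fin k → SPTree α β), IsBundle (fun i => (c i).ttg) T.ttg ∧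
      (∀ i, (c i).IsSPTree) ∧ (∀ i, (c i).IsMinimal) ∧ (∀ i, (c i).IsS ∨ (c i).IsL) := by
  cases T with
  | leaf k X =>
    exact ⟨1, fun _ => leaf k X, .single _, fun _ => hT, fun _ => hmin, fun _ => Or.inr trivial⟩
  | series X c =>
    exact ⟨1, fun _ => series X c, .single _, fun _ => hT, fun _ => hmin,
      fun _ => Or.inl trivial⟩
  | parallel X c => exact ⟨_, c, hT.1.isBundle, hT.2, hmin.2, hmin.1⟩

end SPTree

theorem le_sum_of_forall_pos {m : ℕ} {n : Fin m → ℕ} (h : ∀ i, 0 < n i) : m ≤ ∑ i, n i := by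
  simpa using Finset.sum_le_sum fun i (_ : i ∈ Finset.univ) => Nat.succ_le_of_lt (h i)

/-- Minimal trees of the parts are glued: a series composition absorbs the children of parts that
are S-nodes, and a parallel composition those of parts that are P-nodes. -/
theorem IsTTSPG.exists_minimal_spTree {X : TTG α β} (hX : IsTTSPG X) :
    ∃ T : SPTree α β, T.ttg = X ∧ T.IsSPTree ∧ T.IsMinimal := by
  induction hX with
  | edge X e h =>
    exact ⟨.leaf 1 X, rfl, (IsChain.single X).exists_isPathAlong fun _ => ⟨e, h⟩, trivial⟩
  | @series m X Y _ h ih =>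
    choose T hTX hT hmin using ih
    obtain rfl : (fun i => (T i).ttg) = X := funext hTX
    -- A series of paths must become one leaf, since an S-node needs a child that is a P-node. Any
    -- part that is not a leaf supplies such a child.
    by_cases hL : ∀ i, (T i).IsL
    · choose k Z hZ hZ1 using fun i => SPTree.exists_chain_of_isL (hT i) (hL i)
      exact ⟨.leaf _ Y, rfl, (h.isChain.flatten hZ).exists_isPathAlong fun _ => hZ1 _ _, trivial⟩
    · push Not at hL
      obtain ⟨i, hi⟩ := hL
      choose k c hc hcT hcm hcPL hcP using fun i => SPTree.exists_series_parts (hT i) (hmin i)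
      have hch := h.isChain.flatten hc
      refine ⟨.series Y fun q => c (finSigmaFinEquiv.symm q).1 (finSigmaFinEquiv.symm q).2, rfl,
        ⟨hch.isSeriesComposition (h.two_le.trans (le_sum_of_forall_pos fun i => (hc i).pos)),
          fun _ => hcT _ _⟩, fun _ => hcPL _ _, ?_, fun _ => hcm _ _⟩
      obtain ⟨l, hl⟩ := hcP i hi
      exact (exists_finSigma_iff fun i k => (c i k).IsP).2 ⟨i, l, hl⟩
  | @parallel m X Y _ h ih =>
    choose T hTX hT hmin using ih
    obtain rfl : (fun i => (T i).ttg) = X := funext hTX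
    choose k c hc hcT hcm hcSL using fun i => SPTree.exists_parallel_parts (hT i) (hmin i)
    have hch := h.isBundle.flatten hc
    exact ⟨.parallel Y fun q => c (finSigmaFinEquiv.symm q).1 (finSigmaFinEquiv.symm q).2, rfl,
      ⟨hch.isParallelComposition (h.two_le.trans (le_sum_of_forall_pos fun i => (hc i).pos)),
        fun _ => hcT _ _⟩, fun _ => hcSL _ _, fun _ => hcm _ _⟩

/-! ### Finiteness, connectedness and looplessness -/

open Classical in
/-- A finite set as a finset. -/
noncomputable def finsetOf {γ : Type*} (s : Set γ) : Finset γ :=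
  if h : s.Finite then h.toFinset else ∅

theorem mem_finsetOf {γ : Type*} {s : Set γ} (h : s.Finite) {x : γ} : x ∈ finsetOf s ↔ x ∈ s := by
  rw [finsetOf, dif_pos h, Set.Finite.mem_toFinset]

theorem card_finsetOf {γ : Type*} {s : Set γ} (h : s.Finite) : (finsetOf s).card = s.ncard := by
  rw [finsetOf, dif_pos h, Set.ncard_eq_toFinset_card s h]

/-- The vertices of a finite two-terminal graph. -/
noncomputable def TTG.verts (X : TTG α β) : Finset α := finsetOf X.graph.vertexSet

/-- The edges of a finite two-terminal graph. -/
noncomputable def TTG.edges (X : TTG α β) : Finset β := finsetOf X.graph.edgeSet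

/-- The properties shared by the graphs of all nodes of an SP-tree. -/
structure TTG.IsGood (X : TTG α β) : Prop where
  finite_verts : X.graph.vertexSet.Finite
  finite_edges : X.graph.edgeSet.Finite
  ne_of_isLink : ∀ e x y, X.graph.IsLink e x y → x ≠ y
  connected : ∀ A : Set α, (∀ e x y, X.graph.IsLink e x y → x ∈ A → y ∈ A) →
    ∀ p ∈ X.graph.vertexSet, p ∈ A → ∀ q ∈ X.graph.vertexSet, q ∈ A

theorem TTG.IsGood.mem_verts {X : TTG α β} (hX : X.IsGood) {x : α} :
    x ∈ X.verts ↔ x ∈ X.graph.vertexSet := mem_finsetOf hX.finite_verts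

theorem TTG.IsGood.mem_edges {X : TTG α β} (hX : X.IsGood) {e : β} :
    e ∈ X.edges ↔ e ∈ X.graph.edgeSet := mem_finsetOf hX.finite_edges

theorem TTG.IsGood.card_verts {X : TTG α β} (hX : X.IsGood) : X.verts.card = X.card :=
  card_finsetOf hX.finite_verts

namespace IsEdgeDisjointUnion

variable {m : ℕ} {X : Fin m → TTG α β} {Y : TTG α β}

theorem isLink (h : IsEdgeDisjointUnion X Y) {i : Fin m} {e : β} {x y : α}
    (he : (X i).graph.IsLink e x y) : Y.graph.IsLink e x y := (h.isLink_iff e x y).2 ⟨i, he⟩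

theorem mem_vertexSet (h : IsEdgeDisjointUnion X Y) {i : Fin m} {x : α}
    (hx : x ∈ (X i).graph.vertexSet) : x ∈ Y.graph.vertexSet := by
  rw [h.vertexSet_eq]
  exact Set.mem_iUnion_of_mem i hx

theorem edgeSet_eq (h : IsEdgeDisjointUnion X Y) : Y.graph.edgeSet = ⋃ i, (X i).graph.edgeSet := by
  ext e
  rw [Set.mem_iUnion, Graph.edge_mem_iff_exists_isLink]
  simp only [h.isLink_iff, Graph.edge_mem_iff_exists_isLink]
  exact ⟨fun ⟨x, y, i, h⟩ => ⟨i, x, y, h⟩, fun ⟨i, x, y, h⟩ => ⟨x, y, i, h⟩⟩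

theorem finite_verts (h : IsEdgeDisjointUnion X Y) (hX : ∀ i, (X i).IsGood) :
    Y.graph.vertexSet.Finite := by
  rw [h.vertexSet_eq]
  exact Set.finite_iUnion fun i => (hX i).finite_verts

theorem finite_edges (h : IsEdgeDisjointUnion X Y) (hX : ∀ i, (X i).IsGood) :
    Y.graph.edgeSet.Finite := by
  rw [h.edgeSet_eq]
  exact Set.finite_iUnion fun i => (hX i).finite_edges

theorem ne_of_isLink (h : IsEdgeDisjointUnion X Y) (hX : ∀ i, (X i).IsGood) (e : β) (x y : α)
    (he : Y.graph.IsLink e x y) : x ≠ y := by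
  obtain ⟨i, hi⟩ := (h.isLink_iff e x y).1 he
  exact (hX i).ne_of_isLink e x y hi

theorem sum_edges (h : IsEdgeDisjointUnion X Y) (hX : ∀ i, (X i).IsGood) (f : β → ℕ) :
    ∑ e ∈ Y.edges, f e = ∑ i, ∑ e ∈ (X i).edges, f e := by
  classical
  have hE : Y.edges = Finset.univ.biUnion fun i => (X i).edges := by
    ext e
    rw [TTG.edges, mem_finsetOf (h.finite_edges hX), h.edgeSet_eq]
    simp [(hX _).mem_edges]
  rw [hE, Finset.sum_biUnion]
  intro i _ j _ hij
  rw [Function.onFun, Finset.disjoint_left]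
  intro e hi hj
  exact Set.disjoint_left.1 (h.edge_disjoint i j hij) ((hX i).mem_edges.1 hi)
    ((hX j).mem_edges.1 hj)

theorem card_edges (h : IsEdgeDisjointUnion X Y) (hX : ∀ i, (X i).IsGood) :
    Y.edges.card = ∑ i, (X i).edges.card := by
  simpa using h.sum_edges hX fun _ => 1

end IsEdgeDisjointUnion

theorem IsPathAlong.edgeSet_eq {X : TTG α β} {k : ℕ} {v : Fin (k + 1) → α} {e : Fin k → β}
    (h : IsPathAlong X v e) : X.graph.edgeSet = Set.range e := by
  ext f
  rw [Graph.edge_mem_iff_exists_isLink]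
  simp only [h.isLink_iff]
  constructor
  · rintro ⟨x, y, i, rfl, _⟩
    exact ⟨i, rfl⟩
  · rintro ⟨i, rfl⟩
    exact ⟨_, _, i, rfl, Or.inl ⟨rfl, rfl⟩⟩

theorem IsPathAlong.isGood {X : TTG α β} {k : ℕ} {v : Fin (k + 1) → α} {e : Fin k → β}
    (h : IsPathAlong X v e) : X.IsGood where
  finite_verts := by
    rw [h.vertexSet_eq]
    exact Set.finite_range v
  finite_edges := by
    rw [h.edgeSet_eq]
    exact Set.finite_range e
  ne_of_isLink f x y hf hxy := by
    obtain ⟨i, _, ⟨h1, h2⟩ | ⟨h1, h2⟩⟩ := (h.isLink_iff f x y).1 hf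
    · have := congrArg Fin.val (h.vertex_injective (h1.symm.trans (hxy.trans h2)))
      simp at this
    · have := congrArg Fin.val (h.vertex_injective (h1.symm.trans (hxy.trans h2)))
      simp at this
  connected A hA := by
    have hlink : ∀ i : Fin k, X.graph.IsLink (e i) (v i.castSucc) (v i.succ) := fun i =>
      (h.isLink_iff _ _ _).2 ⟨i, rfl, Or.inl ⟨rfl, rfl⟩⟩
    have key : ∀ i : Fin (k + 1), v i ∈ A ↔ v 0 ∈ A := by
      intro i
      induction i using Fin.induction with
      | zero => rfl
      | succ i ih => exact ⟨fun hi => ih.1 (hA _ _ _ (hlink i).symm hi),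
          fun h0 => hA _ _ _ (hlink i) (ih.2 h0)⟩
    rw [h.vertexSet_eq]
    rintro _ ⟨i, rfl⟩ hi _ ⟨j, rfl⟩
    exact (key j).2 ((key i).1 hi)

theorem IsSeriesComposition.isGood {m : ℕ} {X : Fin m → TTG α β} {Y : TTG α β}
    (h : IsSeriesComposition X Y) (hX : ∀ i, (X i).IsGood) : Y.IsGood where
  finite_verts := h.union.finite_verts hX
  finite_edges := h.union.finite_edges hX
  ne_of_isLink := h.union.ne_of_isLink hX
  connected A hA := by
    have hm := h.two_le
    have hall : ∀ i, ∀ p ∈ (X i).graph.vertexSet, p ∈ A → ∀ q ∈ (X i).graph.vertexSet, q ∈ A :=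
      fun i => (hX i).connected A fun e x y he => hA e x y (h.union.isLink he)
    have key : ∀ i (hi : i < m), (X ⟨i, hi⟩).source ∈ A ↔ (X ⟨0, by omega⟩).source ∈ A := by
      intro i
      induction i with
      | zero => intro; rfl
      | succ i ih =>
        intro hi
        rw [← ih (by omega), ← h.sink_eq_source ⟨i, by omega⟩ ⟨i + 1, hi⟩ rfl]
        exact ⟨fun h => hall _ _ (X _).sink_mem h _ (X _).source_mem,
          fun h => hall _ _ (X _).source_mem h _ (X _).sink_mem⟩
    rw [h.union.vertexSet_eq]
    intro p hp hpA q hq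
    obtain ⟨i, hi⟩ := Set.mem_iUnion.1 hp
    obtain ⟨j, hj⟩ := Set.mem_iUnion.1 hq
    exact hall j _ (X j).source_mem ((key j j.2).2 ((key i i.2).1
      (hall i p hi hpA _ (X i).source_mem))) q hj

theorem IsParallelComposition.isGood {m : ℕ} {X : Fin m → TTG α β} {Y : TTG α β}
    (h : IsParallelComposition X Y) (hX : ∀ i, (X i).IsGood) : Y.IsGood where
  finite_verts := h.union.finite_verts hX
  finite_edges := h.union.finite_edges hX
  ne_of_isLink := h.union.ne_of_isLink hX
  connected A hA := by
    have hall : ∀ i, ∀ p ∈ (X i).graph.vertexSet, p ∈ A → ∀ q ∈ (X i).graph.vertexSet, q ∈ A :=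
      fun i => (hX i).connected A fun e x y he => hA e x y (h.union.isLink he)
    rw [h.union.vertexSet_eq]
    intro p hp hpA q hq
    obtain ⟨i, hi⟩ := Set.mem_iUnion.1 hp
    obtain ⟨j, hj⟩ := Set.mem_iUnion.1 hq
    refine hall j _ (X j).source_mem ?_ q hj
    rw [h.source_eq j, ← h.source_eq i]
    exact hall i p hi hpA _ (X i).source_mem

theorem SPTree.IsSPTree.isGood {T : SPTree α β} (hT : T.IsSPTree) : T.ttg.IsGood := by
  induction T with
  | leaf k X =>
    obtain ⟨v, e, h⟩ := hT
    exact h.isGood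
  | series X c ih => exact hT.1.isGood fun i => ih i (hT.2 i)
  | parallel X c ih => exact hT.1.isGood fun i => ih i (hT.2 i)

/-! ### The computed arrangements -/

theorem zigzag_perm (l : List α) : (zigzag l).Perm l := by
  induction h : l.length using Nat.strong_induction_on generalizing l with
  | _ n ih =>
    cases l with
    | nil => rw [zigzag]
    | cons a l =>
      rw [zigzag]
      exact ((ih l.reverse.length (by simp [← h]) _ rfl).trans l.reverse_perm).cons a

/-- Two steps of the recursion reverse twice. This puts both ends of a path in front, as the other
layouts do with their terminals. -/
theorem zigzag_cons_append (a b : α) (l : List α) :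
    zigzag (a :: (l ++ [b])) = a :: b :: zigzag l := by
  rw [zigzag, List.reverse_append, List.reverse_singleton, List.singleton_append, zigzag,
    List.reverse_reverse]

/-- The list `l` enumerates the vertices of `X`, starting with the source and the sink. -/
structure Enumerates (l : List α) (X : TTG α β) : Prop where
  nodup : l.Nodup
  mem_iff : ∀ x, x ∈ l ↔ x ∈ X.graph.vertexSet
  exists_tail : ∃ r, l = X.source :: X.sink :: r

theorem IsPathAlong.enumerates {X : TTG α β} {k : ℕ} {v : Fin (k + 1) → α} {e : Fin k → β}
    (h : IsPathAlong X v e) : Enumerates (zigzag (List.ofFn v)) X where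
  nodup := (zigzag_perm _).nodup_iff.2 (List.nodup_ofFn.2 h.vertex_injective)
  mem_iff x := by
    rw [(zigzag_perm _).mem_iff, List.mem_ofFn', h.vertexSet_eq]
  exists_tail := by
    cases k with
    | zero => exact absurd (h.source_eq.trans h.sink_eq.symm) X.source_ne_sink
    | succ k =>
      rw [List.ofFn_succ, List.ofFn_succ', List.concat_eq_append, zigzag_cons_append, h.source_eq,
        h.sink_eq]
      exact ⟨_, rfl⟩

section Arrangement

variable [DecidableEq α]

theorem SPTree.IsSPTree.exists_arrangement {T : SPTree α β} (hT : T.IsSPTree) :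
    ∃ l, SPGAA T l := by
  induction T with
  | leaf k X =>
    obtain ⟨v, e, h⟩ := hT
    exact ⟨_, .leaf X v e h⟩
  | @series X m c ih =>
    have hm := hT.1.two_le
    have : Nonempty (Fin m) := ⟨⟨0, by omega⟩⟩
    choose l hl using fun i => ih i (hT.2 i)
    obtain ⟨a, ha⟩ := Finite.exists_max fun i => (c i).ttg.card
    exact ⟨_, .series X c l hl a ha⟩
  | @parallel X m c ih =>
    have hm := hT.1.two_le
    have : Nonempty (Fin m) := ⟨⟨0, by omega⟩⟩
    choose l hl using fun i => ih i (hT.2 i)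
    obtain ⟨a, ha⟩ := Finite.exists_max fun i => (c i).ttg.card
    exact ⟨_, .parallel X c l hl a ha ((List.finRange m).erase a)
      ((List.perm_append_singleton _ _).trans
        (List.perm_cons_erase (List.mem_finRange a)).symm)⟩

theorem Enumerates.filter_tail {l : List α} {X : TTG α β} {r : List α}
    (h : Enumerates l X) (hr : l = X.source :: X.sink :: r) :
    (l.filter fun x => x ≠ X.source ∧ x ≠ X.sink) = r := by
  have hn := h.nodup
  subst hr
  have h1 : X.source ∉ r := fun hx => by simp_all
  have h2 : X.sink ∉ r := fun hx => by simp_all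
  simp only [ne_eq, List.filter_cons]
  simp only [not_true_eq_false, false_and, and_false, decide_false, Bool.false_eq_true, if_false]
  rw [List.filter_eq_self]
  intro x hx
  simp only [decide_eq_true_eq]
  exact ⟨fun h => h1 (h ▸ hx), fun h => h2 (h ▸ hx)⟩

theorem IsParallelComposition.enumerates {m : ℕ} {X : Fin m → TTG α β} {Y : TTG α β}
    (h : IsParallelComposition X Y) {l : Fin m → List α} (hl : ∀ i, Enumerates (l i) (X i))
    {order : List (Fin m)} (ho : order.Perm (List.finRange m)) :
    Enumerates (parallelLayout Y.source Y.sink l order) Y where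
  nodup := by
    have hv := Y.source_ne_sink
    simp only [parallelLayout, List.nodup_cons, List.mem_cons, List.mem_flatMap, List.mem_filter,
      decide_eq_true_eq]
    refine ⟨by grind, by grind, List.nodup_flatMap.2 ⟨fun i _ => (hl i).nodup.filter _, ?_⟩⟩
    refine (ho.nodup_iff.2 (List.nodup_finRange m)).imp fun {i j} hij => ?_
    simp only [Function.onFun, List.disjoint_left, List.mem_filter, decide_eq_true_eq]
    rintro x ⟨hx, hxu, hxv⟩ ⟨hx', -⟩
    rcases h.vertex_disjoint i j hij x (((hl i).mem_iff x).1 hx) (((hl j).mem_iff x).1 hx') with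
      h | h
    · exact hxu h
    · exact hxv h
  mem_iff x := by
    simp only [parallelLayout, List.mem_cons, List.mem_flatMap, List.mem_filter,
      decide_eq_true_eq, (hl _).mem_iff, ho.mem_iff, List.mem_finRange, true_and]
    constructor
    · rintro (rfl | rfl | ⟨i, hx, -⟩)
      · exact Y.source_mem
      · exact Y.sink_mem
      · exact h.union.mem_vertexSet hx
    · intro hx
      rw [h.union.vertexSet_eq] at hx
      obtain ⟨i, hi⟩ := Set.mem_iUnion.1 hx
      by_cases hu : x = Y.source
      · exact Or.inl hu
      by_cases hv : x = Y.sink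
      · exact Or.inr (Or.inl hv)
      exact Or.inr (Or.inr ⟨i, hi, hu, hv⟩)
  exists_tail := ⟨_, rfl⟩

/-- The part of a series layout that belongs to the `i`-th child. -/
def seriesBlock {m : ℕ} (u : α) (l : Fin m → List α) (t : Fin m → α) (i : Fin m) : List α :=
  (l i).filter fun x => x ≠ t i ∧ x ≠ u

theorem seriesLayout_eq {m : ℕ} (u v : α) (l : Fin m → List α) (t : Fin m → α) (a : Fin m) :
    seriesLayout u v l t a =
      u :: v :: (((List.finRange m).filter fun i => i < a).flatMap (seriesBlock u l t) ++
        ((List.finRange m).filter fun i => a < i).reverse.flatMap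
          (fun i => (seriesBlock u l t i).reverse) ++ seriesBlock u l t a) := rfl

section Series

variable {m : ℕ} {X : Fin m → TTG α β} {Y : TTG α β} {l : Fin m → List α}

theorem mem_seriesBlock (hl : ∀ i, Enumerates (l i) (X i)) {i : Fin m} {x : α} :
    x ∈ seriesBlock Y.source l (fun i => (X i).sink) i ↔
      x ∈ (X i).graph.vertexSet ∧ x ≠ (X i).sink ∧ x ≠ Y.source := by
  simp [seriesBlock, (hl _).mem_iff]

theorem IsSeriesComposition.seriesBlock_disjoint (h : IsSeriesComposition X Y)
    (hl : ∀ i, Enumerates (l i) (X i)) {i j : Fin m} (hij : i ≠ j) :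
    List.Disjoint (seriesBlock Y.source l (fun i => (X i).sink) i)
      (seriesBlock Y.source l (fun i => (X i).sink) j) := by
  intro x hi hj
  rw [mem_seriesBlock hl] at hi hj
  rcases lt_or_gt_of_ne hij with hij | hij
  · exact hi.2.1 (h.vertex_disjoint i j hij x hi.1 hj.1).2
  · exact hj.2.1 (h.vertex_disjoint j i hij x hj.1 hi.1).2

/-- The last child loses this vertex as its own sink. An earlier child that contained it would share
it with the last child, so it would be the sink there too. -/
theorem IsSeriesComposition.sink_notMem_seriesBlock (h : IsSeriesComposition X Y)
    (hl : ∀ i, Enumerates (l i) (X i)) (i : Fin m) :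
    Y.sink ∉ seriesBlock Y.source l (fun i => (X i).sink) i := by
  intro hi
  rw [mem_seriesBlock hl] at hi
  have hm := h.two_le
  have hlast := h.sink_eq ⟨m - 1, by omega⟩ (by dsimp only; omega)
  by_cases him : (i : ℕ) + 1 = m
  · exact hi.2.1 (h.sink_eq i him)
  · exact hi.2.1 (h.vertex_disjoint i ⟨m - 1, by omega⟩ (Fin.lt_def.2 (by dsimp only; omega)) _
      hi.1 (by rw [hlast]; exact (X _).sink_mem)).2

/-- Nothing is lost by deleting sinks: the sink of a child survives as the source of the next child,
and the last one is the sink of the whole. -/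
theorem IsSeriesComposition.mem_vertexSet_iff (h : IsSeriesComposition X Y)
    (hl : ∀ i, Enumerates (l i) (X i)) (x : α) : x ∈ Y.graph.vertexSet ↔
      x = Y.source ∨ x = Y.sink ∨
        ∃ i, x ∈ seriesBlock Y.source l (fun i => (X i).sink) i := by
  simp only [mem_seriesBlock hl]
  constructor
  · intro hx
    rw [h.union.vertexSet_eq] at hx
    obtain ⟨i, hi⟩ := Set.mem_iUnion.1 hx
    by_cases hu : x = Y.source
    · exact Or.inl hu
    refine Or.inr ?_
    by_cases ht : x = (X i).sink
    · by_cases him : (i : ℕ) + 1 = m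
      · exact Or.inl (ht.trans (h.sink_eq i him).symm)
      · have hs := h.sink_eq_source i ⟨i + 1, by omega⟩ rfl
        refine Or.inr ⟨⟨i + 1, by omega⟩, ?_, ?_, hu⟩
        · rw [ht, hs]
          exact (X _).source_mem
        · rw [ht, hs]
          exact (X _).source_ne_sink
    · exact Or.inr ⟨i, hi, ht, hu⟩
  · rintro (rfl | rfl | ⟨i, hx, -⟩)
    · exact Y.source_mem
    · exact Y.sink_mem
    · exact h.union.mem_vertexSet hx

theorem IsSeriesComposition.enumerates (h : IsSeriesComposition X Y)
    (hl : ∀ i, Enumerates (l i) (X i)) (a : Fin m) :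
    Enumerates (seriesLayout Y.source Y.sink l (fun i => (X i).sink) a) Y where
  nodup := by
    have hv := Y.source_ne_sink
    have hn : ∀ i, (seriesBlock Y.source l (fun i => (X i).sink) i).Nodup :=
      fun i => (hl i).nodup.filter _
    have hu : ∀ i, Y.source ∉ seriesBlock Y.source l (fun i => (X i).sink) i := by
      intro i
      rw [mem_seriesBlock hl]
      exact fun h => h.2.2 rfl
    have ht := h.sink_notMem_seriesBlock hl
    have hd := fun i j (hij : i ≠ j) => h.seriesBlock_disjoint hl hij
    rw [seriesLayout_eq]
    generalize seriesBlock Y.source l (fun i => (X i).sink) = b at *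
    have hP : ∀ p : Fin m → Bool, (((List.finRange m).filter p).flatMap b).Nodup := by
      intro p
      refine List.nodup_flatMap.2 ⟨fun i _ => hn i, ?_⟩
      exact ((List.nodup_finRange m).filter _).imp fun {i j} hij => hd i j hij
    have hP' : ∀ p : Fin m → Bool,
        (((List.finRange m).filter p).reverse.flatMap fun i => (b i).reverse).Nodup := by
      intro p
      rw [show (fun i => (b i).reverse) = List.reverse ∘ b from rfl, ← List.reverse_flatMap]
      exact List.nodup_reverse.2 (hP p)
    simp only [List.nodup_cons, List.nodup_append', List.mem_cons, List.mem_append,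
      List.mem_flatMap, List.mem_reverse, List.mem_filter, List.mem_finRange, true_and,
      decide_eq_true_eq]
    refine ⟨by grind, by grind, ⟨hP _, hP' _, ?_⟩, hn a, ?_⟩
    · intro x hx hx'
      simp only [List.mem_flatMap, List.mem_reverse, List.mem_filter, List.mem_finRange, true_and,
        decide_eq_true_eq] at hx hx'
      obtain ⟨i, hi, hxi⟩ := hx
      obtain ⟨j, hj, hxj⟩ := hx'
      exact hd i j (hi.trans hj).ne hxi hxj
    · intro x hx hx'
      simp only [List.mem_append, List.mem_flatMap, List.mem_reverse, List.mem_filter,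
        List.mem_finRange, true_and, decide_eq_true_eq] at hx
      rcases hx with ⟨i, hi, hxi⟩ | ⟨i, hi, hxi⟩
      · exact hd i a hi.ne hxi hx'
      · exact hd i a hi.ne' hxi hx'
  mem_iff x := by
    rw [h.mem_vertexSet_iff hl, seriesLayout_eq]
    simp only [List.mem_cons, List.mem_append, List.mem_flatMap, List.mem_reverse,
      List.mem_filter, List.mem_finRange, true_and, decide_eq_true_eq]
    refine or_congr_right (or_congr_right ⟨?_, ?_⟩)
    · rintro ((⟨i, -, hi⟩ | ⟨i, -, hi⟩) | hi)
      exacts [⟨i, hi⟩, ⟨i, hi⟩, ⟨a, hi⟩]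
    · rintro ⟨i, hi⟩
      rcases lt_trichotomy i a with hia | rfl | hia
      exacts [Or.inl (Or.inl ⟨i, hia, hi⟩), Or.inr hi, Or.inl (Or.inr ⟨i, hia, hi⟩)]
  exists_tail := ⟨_, rfl⟩

end Series

theorem SPGAA.enumerates {T : SPTree α β} {l : List α} (h : SPGAA T l) (hT : T.IsSPTree) :
    Enumerates l T.ttg := by
  induction h with
  | leaf X v e h => exact h.enumerates
  | series X c l _ a _ ih => exact hT.1.enumerates (fun i => ih i (hT.2 i)) a
  | parallel X c l _ a _ others ho ih => exact hT.1.enumerates (fun i => ih i (hT.2 i)) ho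

theorem Enumerates.length_eq {l : List α} {X : TTG α β} (h : Enumerates l X) :
    l.length = X.card := by
  have : X.graph.vertexSet = (l.toFinset : Set α) := by
    ext x
    simp [h.mem_iff]
  rw [TTG.card, this, Set.ncard_coe_finset, List.toFinset_card_of_nodup h.nodup]

theorem Enumerates.isLinearArrangement {l : List α} {X : TTG α β} (h : Enumerates l X) :
    IsLinearArrangement X.graph (position l) := by
  rw [IsLinearArrangement, show X.graph.vertexSet.ncard = l.length from h.length_eq.symm]
  refine ⟨fun x hx => ?_, fun x hx y hy hxy => ?_, fun n hn => ?_⟩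
  · have := List.idxOf_lt_length_of_mem ((h.mem_iff x).2 hx)
    exact ⟨Nat.succ_pos _, this⟩
  · exact (List.idxOf_inj ((h.mem_iff x).2 hx)).1 (Nat.succ_injective hxy)
  · obtain ⟨h1, h2⟩ := hn
    refine ⟨l[n - 1], (h.mem_iff _).1 (List.getElem_mem _), ?_⟩
    rw [position, h.nodup.idxOf_getElem]
    omega

end Arrangement

/-! ### Upper bound: leaves -/

theorem length_flatMap_filter_finRange {m : ℕ} (f : Fin m → List α) (p : Fin m → Prop)
    [DecidablePred p] :
    (((List.finRange m).filter p).flatMap f).length = ∑ k with p k, (f k).length := by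
  rw [List.length_flatMap, ← List.sum_toFinset _ ((List.nodup_finRange m).filter _)]
  congr 1
  ext
  simp

theorem ofFn_eq_append {k : ℕ} (v : Fin (k + 1) → α) (i : Fin k) :
    ∃ s t, List.ofFn v = s ++ v i.castSucc :: v i.succ :: t := by
  refine ⟨(List.ofFn v).take i, (List.ofFn v).drop (i + 2), ?_⟩
  have h2 : (i : ℕ) + 1 < (List.ofFn v).length := by simp
  have h1 : (i : ℕ) < (List.ofFn v).length := by omega
  conv_lhs => rw [← List.take_append_drop i (List.ofFn v), List.drop_eq_getElem_cons h1,
    List.drop_eq_getElem_cons h2]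
  simp only [List.getElem_ofFn]
  rfl

section ListPositions

variable [DecidableEq α]

theorem edgeLength_position {G : Graph α β} {e : β} {x y : α} (l : List α) (h : G.IsLink e x y) :
    edgeLength G (position l) e = ((l.idxOf x : ℤ) - l.idxOf y).natAbs := by
  rw [edgeLength_eq _ h, position, position]
  omega

theorem idxOf_zigzag_last_le (l : List α) (x : α) : (zigzag (l ++ [x])).idxOf x ≤ 1 := by
  cases l with
  | nil => simp [zigzag]
  | cons a l =>
    rw [List.cons_append, zigzag_cons_append]
    by_cases h : a = x
    · rw [List.idxOf_cons_eq _ h]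
      exact zero_le_one
    · rw [List.idxOf_cons_ne _ h, List.idxOf_cons_self]

/-- Neighbours that avoid the head stay neighbours in the reversed tail, where induction applies. If
the head is one of them, the other is last in the reversed tail and so has index at most 1 in its
zigzag. -/
theorem natAbs_idxOf_zigzag_le {l : List α} (hl : l.Nodup) {s t : List α} {x y : α}
    (h : l = s ++ x :: y :: t) :
    (((zigzag l).idxOf x : ℤ) - (zigzag l).idxOf y).natAbs ≤ 2 := by
  induction hn : l.length using Nat.strong_induction_on generalizing l s t x y with
  | _ n ih =>
    cases l with
    | nil => simp at h
    | cons a l =>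
      rw [zigzag]
      cases s with
      | nil =>
        simp only [List.nil_append, List.cons.injEq] at h
        obtain ⟨rfl, rfl⟩ := h
        have hay : a ≠ y := by rintro rfl; simp at hl
        have := idxOf_zigzag_last_le t.reverse y
        rw [List.reverse_cons, List.idxOf_cons_self, List.idxOf_cons_ne _ hay]
        omega
      | cons b s =>
        simp only [List.cons_append, List.cons.injEq] at h
        obtain ⟨rfl, rfl⟩ := h
        have hax : a ≠ x := by rintro rfl; simp at hl
        have hay : a ≠ y := by rintro rfl; simp at hl
        have h1 := ih _ (by rw [← hn, List.length_reverse]; simp) (l := (s ++ x :: y :: t).reverse)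
          (s := t.reverse) (t := s.reverse) (x := y) (y := x)
          (List.nodup_reverse.2 (List.nodup_cons.1 hl).2) (by simp) rfl
        rw [List.idxOf_cons_ne _ hax, List.idxOf_cons_ne _ hay]
        omega

theorem IsPathAlong.sum_edgeLength_le {X : TTG α β} {k : ℕ} {v : Fin (k + 1) → α} {e : Fin k → β}
    (h : IsPathAlong X v e) :
    ∑ f ∈ X.edges, edgeLength X.graph (position (zigzag (List.ofFn v))) f ≤ 2 * X.edges.card := by
  rw [mul_comm, ← smul_eq_mul]
  refine Finset.sum_le_card_nsmul _ _ _ fun f hf => ?_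
  rw [h.isGood.mem_edges, h.edgeSet_eq] at hf
  obtain ⟨i, rfl⟩ := hf
  rw [edgeLength_position _ ((h.isLink_iff _ _ _).2 ⟨i, rfl, Or.inl ⟨rfl, rfl⟩⟩)]
  obtain ⟨s, t, hst⟩ := ofFn_eq_append v i
  exact natAbs_idxOf_zigzag_le (List.nodup_ofFn.2 h.vertex_injective) hst

/-! ### Positions in concatenations -/

theorem idxOf_flatMap {ι : Type*} {f : ι → List α} {s t : List ι} {i : ι} {x : α} (hx : x ∈ f i)
    (hs : ∀ k ∈ s, x ∉ f k) :
    ((s ++ i :: t).flatMap f).idxOf x = (s.map fun k => (f k).length).sum + (f i).idxOf x := by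
  have h1 : x ∉ s.flatMap f := by
    rw [List.mem_flatMap]
    rintro ⟨k, hk, hxk⟩
    exact hs k hk hxk
  rw [List.flatMap_append, List.idxOf_append_of_notMem h1, List.flatMap_cons,
    List.idxOf_append_of_mem hx, List.length_flatMap]

/-- The order `r` is left general because a series layout lists the children before `a` in
increasing order and those after `a` in decreasing order. -/
theorem idxOf_flatMap_of_pairwise {ι : Type*} [DecidableEq ι] {r : ι → ι → Prop} [DecidableRel r]
    (hr : ∀ i j, r i j → ¬ r j i) {f : ι → List α} {s : List ι} (hs : s.Pairwise r) {i : ι}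
    (hi : i ∈ s) {x : α} (hx : x ∈ f i) (hf : ∀ k ∈ s, k ≠ i → x ∉ f k) :
    (s.flatMap f).idxOf x =
      ∑ k ∈ s.toFinset with r k i, (f k).length + (f i).idxOf x := by
  have hirr : ∀ i, ¬ r i i := fun i h => hr i i h h
  obtain ⟨p, q, rfl⟩ := List.append_of_mem hi
  rw [List.pairwise_append, List.pairwise_cons] at hs
  obtain ⟨hp, ⟨hq, -⟩, hpq⟩ := hs
  have hpi : ∀ k ∈ p, r k i := fun k hk => hpq k hk i (by simp)
  rw [idxOf_flatMap hx fun k hk => hf k (by simp [hk]) (by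
    rintro rfl
    exact hirr _ (hpi _ hk))]
  have hfin : (p ++ i :: q).toFinset.filter (fun k => r k i) = p.toFinset := by
    ext k
    simp only [Finset.mem_filter, List.mem_toFinset, List.mem_append, List.mem_cons]
    constructor
    · rintro ⟨h | rfl | h, hk⟩
      · exact h
      · exact (hirr _ hk).elim
      · exact (hr _ _ hk (hq k h)).elim
    · exact fun h => ⟨Or.inl h, hpi k h⟩
  rw [hfin, List.sum_toFinset]
  refine hp.imp fun {a b} h hab => ?_
  subst hab
  exact hirr a h

end ListPositions

/-! ### Degrees and loads -/

open Classical in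
/-- The number of edges at a vertex (in a graph without loops). -/
noncomputable def TTG.deg (X : TTG α β) (w : α) : ℕ :=
  ∑ e ∈ X.edges, if X.graph.Inc e w then 1 else 0

namespace IsEdgeDisjointUnion

variable {m : ℕ} {X : Fin m → TTG α β} {Y : TTG α β}

theorem isLink_iff_of_mem (h : IsEdgeDisjointUnion X Y) {i : Fin m} {e : β}
    (he : e ∈ (X i).graph.edgeSet) (x y : α) :
    Y.graph.IsLink e x y ↔ (X i).graph.IsLink e x y := by
  refine ⟨fun hY => ?_, h.isLink⟩
  obtain ⟨j, hj⟩ := (h.isLink_iff e x y).1 hY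
  by_cases hij : i = j
  · rwa [hij]
  · exact (Set.disjoint_left.1 (h.edge_disjoint i j hij) he hj.edge_mem).elim

theorem inc_iff_of_mem (h : IsEdgeDisjointUnion X Y) {i : Fin m} {e : β}
    (he : e ∈ (X i).graph.edgeSet) (x : α) : Y.graph.Inc e x ↔ (X i).graph.Inc e x :=
  exists_congr fun y => h.isLink_iff_of_mem he x y

theorem deg_eq (h : IsEdgeDisjointUnion X Y) (hX : ∀ i, (X i).IsGood) (w : α) :
    Y.deg w = ∑ i, (X i).deg w := by
  classical
  rw [TTG.deg, h.sum_edges hX]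
  refine Finset.sum_congr rfl fun i _ => Finset.sum_congr rfl fun e he => ?_
  exact if_congr (h.inc_iff_of_mem ((hX i).mem_edges.1 he) w) rfl rfl

theorem deg_le (h : IsEdgeDisjointUnion X Y) (hX : ∀ i, (X i).IsGood) (i : Fin m) (w : α) :
    (X i).deg w ≤ Y.deg w := by
  rw [h.deg_eq hX]
  exact Finset.single_le_sum (f := fun i => (X i).deg w) (fun _ _ => Nat.zero_le _)
    (Finset.mem_univ i)

end IsEdgeDisjointUnion

/-- The number of vertices outside a biggest child, summed over all inner nodes. -/
noncomputable def SPTree.load : SPTree α β → ℕ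
  | leaf _ _ => 0
  | series X child => (X.card - Finset.univ.sup fun i => (child i).ttg.card) + ∑ i, (child i).load
  | parallel X child =>
      (X.card - Finset.univ.sup fun i => (child i).ttg.card) + ∑ i, (child i).load

theorem sup_eq_of_forall_le {m : ℕ} {f : Fin m → ℕ} {a : Fin m} (h : ∀ i, f i ≤ f a) :
    Finset.univ.sup f = f a :=
  le_antisymm (Finset.sup_le fun i _ => h i) (Finset.le_sup (Finset.mem_univ a))

/-! ### Upper bound: parallel compositions -/

section UpperBound

variable [DecidableEq α] {m : ℕ} {X : Fin m → TTG α β} {Y : TTG α β} {l : Fin m → List α}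

/-- Read off from the length of a layout, in which each child contributes all its vertices but two.
-/
theorem IsParallelComposition.sum_card (h : IsParallelComposition X Y)
    (hl : ∀ i, Enumerates (l i) (X i)) : ∑ i, (X i).card + 2 = Y.card + 2 * m := by
  have hlen := (h.enumerates hl (List.Perm.refl _)).length_eq
  choose r hr using fun i => (hl i).exists_tail
  have hcard : ∀ i, (X i).card = (r i).length + 2 := by
    intro i
    rw [← (hl i).length_eq, hr i]
    rfl
  have hfilter : ∀ i, (l i).filter (fun x => x ≠ Y.source ∧ x ≠ Y.sink) = r i := by
    intro i
    rw [← h.source_eq i, ← h.sink_eq i]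
    exact (hl i).filter_tail (hr i)
  simp only [parallelLayout, List.length_cons, List.length_flatMap, hfilter] at hlen
  rw [← List.sum_toFinset _ (List.nodup_finRange m), List.toFinset_finRange] at hlen
  simp only [hcard, Finset.sum_add_distrib, Finset.sum_const, Finset.card_univ, Fintype.card_fin,
    smul_eq_mul]
  omega

/-- In a parallel layout only the edges at the terminals become longer. -/
theorem IsParallelComposition.edgeLength_le (h : IsParallelComposition X Y)
    (hl : ∀ i, Enumerates (l i) (X i)) {others : List (Fin m)} {a : Fin m}
    (ho : (others ++ [a]).Perm (List.finRange m)) {i : Fin m} {e : β}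
    (he : e ∈ (X i).graph.edgeSet) [DecidablePred (Y.graph.Inc e)] :
    edgeLength Y.graph (position (parallelLayout Y.source Y.sink l (others ++ [a]))) e ≤
      edgeLength (X i).graph (position (l i)) e +
        ((if Y.graph.Inc e Y.source then 1 else 0) * (Y.card - (X a).card) +
          (if Y.graph.Inc e Y.sink then 1 else 0) * (Y.card - (X a).card)) := by
  have hlen := (h.enumerates hl ho).length_eq
  choose r hr using fun i => (hl i).exists_tail
  have hcard : (X a).card = (r a).length + 2 := by
    rw [← (hl a).length_eq, hr a]
    rfl
  have hfilter : ∀ i, (l i).filter (fun x => x ≠ Y.source ∧ x ≠ Y.sink) = r i := by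
    intro i
    rw [← h.source_eq i, ← h.sink_eq i]
    exact (hl i).filter_tail (hr i)
  simp only [parallelLayout, hfilter] at hlen ⊢
  change (Y.source :: Y.sink :: (others ++ [a]).flatMap r).length = _ at hlen
  change edgeLength Y.graph (position (Y.source :: Y.sink :: (others ++ [a]).flatMap r)) e ≤ _
  have hnd : (others ++ [a]).Nodup := ho.nodup_iff.2 (List.nodup_finRange m)
  have hmem : ∀ i x, x ∈ r i → x ∈ (X i).graph.vertexSet ∧ x ≠ Y.source ∧ x ≠ Y.sink := by
    intro i x hx
    rw [← hfilter i, List.mem_filter, (hl i).mem_iff] at hx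
    simpa using hx
  have hrd : ∀ i j x, i ≠ j → x ∈ r i → x ∉ r j := by
    intro i j x hij hi hj
    rcases h.vertex_disjoint i j hij x (hmem i x hi).1 (hmem j x hj).1 with h | h
    · exact (hmem i x hi).2.1 h
    · exact (hmem i x hi).2.2 h
  -- The shift `c` is the total length of the blocks before child `i`. As child `a` comes last, it
  -- never counts towards this shift.
  obtain ⟨c, hc, hpos⟩ : ∃ c, c ≤ (others.flatMap r).length ∧ ∀ x ∈ r i,
      ((others ++ [a]).flatMap r).idxOf x = c + (r i).idxOf x := by
    have hi : i ∈ others ++ [a] := ho.mem_iff.2 (List.mem_finRange i)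
    rw [List.mem_append, List.mem_singleton] at hi
    rcases hi with hi | rfl
    · obtain ⟨p, q, rfl⟩ := List.append_of_mem hi
      refine ⟨(p.map fun k => (r k).length).sum, ?_, fun x hx => ?_⟩
      · rw [List.flatMap_append, List.length_append, List.length_flatMap]
        exact Nat.le_add_right _ _
      · rw [List.append_assoc, List.cons_append]
        refine idxOf_flatMap hx fun k hk => hrd i k x ?_ hx
        rintro rfl
        simp only [List.append_assoc, List.nodup_append', List.cons_append] at hnd
        exact hnd.2.2 hk (by simp)
    · refine ⟨(others.flatMap r).length, le_rfl, fun x hx => ?_⟩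
      rw [List.length_flatMap]
      refine idxOf_flatMap hx fun k hk => hrd i k x ?_ hx
      rintro rfl
      rw [List.nodup_append'] at hnd
      exact hnd.2.2 hk (by simp)
  have hrest : Y.card - (X a).card = (others.flatMap r).length := by
    rw [← hlen, hcard]
    simp only [List.length_cons, List.flatMap_append, List.flatMap_singleton, List.length_append]
    omega
  rw [hrest]
  obtain ⟨x, y, hxy⟩ := Graph.exists_isLink_of_mem_edgeSet he
  have hxyY := h.union.isLink hxy
  rw [edgeLength_position _ hxy, edgeLength_position _ hxyY]
  -- The terminals keep the indices 0 and 1, and all other vertices of the child move right by `c`.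
  -- Edges with one terminal end grow by at most `c`; all other edges keep their length.
  have hclass : ∀ z ∈ (X i).graph.vertexSet,
      (z = Y.source ∧ (l i).idxOf z = 0 ∧
        (Y.source :: Y.sink :: (others ++ [a]).flatMap r).idxOf z = 0) ∨
      (z = Y.sink ∧ (l i).idxOf z = 1 ∧
        (Y.source :: Y.sink :: (others ++ [a]).flatMap r).idxOf z = 1) ∨
      ∃ j, (l i).idxOf z = j + 2 ∧
        (Y.source :: Y.sink :: (others ++ [a]).flatMap r).idxOf z = c + j + 2 := by
    intro z hz
    have hri := hr i
    rw [h.source_eq i, h.sink_eq i] at hri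
    have hne := Y.source_ne_sink
    by_cases hzu : z = Y.source
    · exact Or.inl ⟨hzu, by rw [hri, hzu, List.idxOf_cons_self], by rw [hzu, List.idxOf_cons_self]⟩
    refine Or.inr ?_
    by_cases hzv : z = Y.sink
    · refine Or.inl ⟨hzv, ?_, ?_⟩
      · rw [hri, hzv, List.idxOf_cons_ne _ hne, List.idxOf_cons_self]
      · rw [hzv, List.idxOf_cons_ne _ hne, List.idxOf_cons_self]
    · refine Or.inr ⟨(r i).idxOf z, ?_, ?_⟩
      · rw [hri, List.idxOf_cons_ne _ (Ne.symm hzu), List.idxOf_cons_ne _ (Ne.symm hzv)]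
      · have hzr : z ∈ r i := by
          have := ((hl i).mem_iff z).2 hz
          rw [hri] at this
          simpa [hzu, hzv] using this
        rw [List.idxOf_cons_ne _ (Ne.symm hzu), List.idxOf_cons_ne _ (Ne.symm hzv), hpos z hzr]
  have hincx := hxyY.inc_left
  have hincy := hxyY.inc_right
  generalize (Y.source :: Y.sink :: (others ++ [a]).flatMap r) = L at hclass ⊢
  rcases hclass x hxy.left_mem with ⟨rfl, h1, h2⟩ | ⟨rfl, h1, h2⟩ | ⟨j, h1, h2⟩ <;>
  rcases hclass y hxy.right_mem with ⟨rfl, h3, h4⟩ | ⟨rfl, h3, h4⟩ | ⟨k, h3, h4⟩ <;>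
  (try simp only [hincx, hincy, if_true, one_mul]) <;>
  omega

theorem IsParallelComposition.sum_edgeLength_le (h : IsParallelComposition X Y)
    (hX : ∀ i, (X i).IsGood)
    (hl : ∀ i, Enumerates (l i) (X i)) {others : List (Fin m)} {a : Fin m}
    (ho : (others ++ [a]).Perm (List.finRange m)) :
    ∑ e ∈ Y.edges,
      edgeLength Y.graph (position (parallelLayout Y.source Y.sink l (others ++ [a]))) e ≤
      ∑ i, ∑ e ∈ (X i).edges, edgeLength (X i).graph (position (l i)) e +
        (Y.deg Y.source + Y.deg Y.sink) * (Y.card - (X a).card) := by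
  classical
  rw [add_mul, TTG.deg, TTG.deg, Finset.sum_mul, Finset.sum_mul, h.union.sum_edges hX,
    ← Finset.sum_add_distrib, h.union.sum_edges hX, ← Finset.sum_add_distrib]
  refine Finset.sum_le_sum fun i _ => ?_
  rw [← Finset.sum_add_distrib]
  refine Finset.sum_le_sum fun e he => ?_
  have := h.edgeLength_le hl ho ((hX i).mem_edges.1 he)
  convert this

end UpperBound

/-! ### Upper bound: series compositions -/

section PartialSums

variable {m : ℕ} (f : Fin m → ℕ)

/-- The sum of the entries before the `i`-th one. -/
def sumBelow (i : Fin m) : ℕ := ∑ k with k < i, f k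

/-- The sum of the entries after the `i`-th one. -/
def sumAbove (i : Fin m) : ℕ := ∑ k with i < k, f k

theorem sumBelow_add_le {i j : Fin m} (h : i < j) : sumBelow f i + f i ≤ sumBelow f j := by
  rw [sumBelow, sumBelow, add_comm, ← Finset.sum_insert (by simp)]
  refine Finset.sum_le_sum_of_subset fun k hk => ?_
  simp only [Finset.mem_insert, Finset.mem_filter, Finset.mem_univ, true_and] at hk ⊢
  rcases hk with rfl | hk
  · exact h
  · exact hk.trans h

theorem sumAbove_add_le {i j : Fin m} (h : i < j) : sumAbove f j + f j ≤ sumAbove f i := by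
  rw [sumAbove, sumAbove, add_comm, ← Finset.sum_insert (by simp)]
  refine Finset.sum_le_sum_of_subset fun k hk => ?_
  simp only [Finset.mem_insert, Finset.mem_filter, Finset.mem_univ, true_and] at hk ⊢
  rcases hk with rfl | hk
  · exact h
  · exact h.trans hk

theorem sumBelow_succ {i j : Fin m} (h : (i : ℕ) + 1 = j) :
    sumBelow f j = sumBelow f i + f i := by
  rw [sumBelow, sumBelow, add_comm, ← Finset.sum_insert (by simp)]
  congr 1
  ext k
  simp only [Finset.mem_insert, Finset.mem_filter, Finset.mem_univ, true_and, Fin.lt_def,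
    Fin.ext_iff]
  omega

theorem sumAbove_succ {i j : Fin m} (h : (i : ℕ) + 1 = j) :
    sumAbove f i = sumAbove f j + f j := by
  rw [sumAbove, sumAbove, add_comm, ← Finset.sum_insert (by simp)]
  congr 1
  ext k
  simp only [Finset.mem_insert, Finset.mem_filter, Finset.mem_univ, true_and, Fin.lt_def,
    Fin.ext_iff]
  omega

theorem sumAbove_last {i : Fin m} (h : (i : ℕ) + 1 = m) : sumAbove f i = 0 := by
  rw [sumAbove, Finset.sum_eq_zero]
  intro k hk
  simp only [Finset.mem_filter, Finset.mem_univ, true_and, Fin.lt_def] at hk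
  omega

theorem sumBelow_add_add_sumAbove (i : Fin m) :
    sumBelow f i + f i + sumAbove f i = ∑ k, f k := by
  rw [← Finset.sum_filter_add_sum_filter_not Finset.univ (fun k => k < i) f, add_assoc, sumBelow,
    sumAbove, ← Finset.sum_insert (by simp)]
  congr 2
  ext k
  simp only [Finset.mem_insert, Finset.mem_filter, Finset.mem_univ, true_and, Fin.lt_def,
    Fin.ext_iff]
  omega

/-- At most one index meets the condition. It is needed for the child just before `a` and for the
last child. -/
theorem sum_ite_val_eq_le (p : Fin m → ℕ) (hp : Function.Injective p) (c K : ℕ) :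
    ∑ i, (if p i = c then K else 0) ≤ K := by
  rw [← Finset.sum_filter, Finset.sum_const, smul_eq_mul]
  have : (Finset.univ.filter fun i => p i = c).card ≤ 1 := by
    refine Finset.card_le_one.2 fun i hi j hj => hp ?_
    simp only [Finset.mem_filter, Finset.mem_univ, true_and] at hi hj
    rw [hi, hj]
  exact (Nat.mul_le_mul_right K this).trans (one_mul K).le

end PartialSums

theorem IsSeriesComposition.source_notMem {m : ℕ} {X : Fin m → TTG α β} {Y : TTG α β}
    (h : IsSeriesComposition X Y) {i : Fin m} (hi : (i : ℕ) ≠ 0) : Y.source ∉ (X i).graph.vertexSet := by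
  intro hu
  have hs := h.source_eq ⟨0, by omega⟩ rfl
  have := h.vertex_disjoint ⟨0, by omega⟩ i (Fin.lt_def.2 (by dsimp only; omega)) _
    (by rw [hs]; exact (X _).source_mem) hu
  exact (X ⟨0, by omega⟩).source_ne_sink (hs.symm.trans this.2)

section UpperBound

variable [DecidableEq α] {m : ℕ} {X : Fin m → TTG α β} {Y : TTG α β} {l : Fin m → List α}

theorem IsSeriesComposition.seriesBlock_zero (h : IsSeriesComposition X Y)
    (hl : ∀ i, Enumerates (l i) (X i)) {i : Fin m} (hi : (i : ℕ) = 0) {r : List α}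
    (hr : l i = (X i).source :: (X i).sink :: r) :
    seriesBlock Y.source l (fun i => (X i).sink) i = r := by
  rw [← (hl i).filter_tail hr, seriesBlock, h.source_eq i hi]
  simp only [and_comm]

/-- Only the first child contains the source of the whole, so here the deletion of `u` has no effect
and the block starts with the source of the child. -/
theorem IsSeriesComposition.seriesBlock_of_ne_zero (h : IsSeriesComposition X Y)
    (hl : ∀ i, Enumerates (l i) (X i)) {i : Fin m} (hi : (i : ℕ) ≠ 0) {r : List α}
    (hr : l i = (X i).source :: (X i).sink :: r) :
    seriesBlock Y.source l (fun i => (X i).sink) i = (X i).source :: r := by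
  have hu := h.source_notMem hi
  have hn := (hl i).nodup
  have hmem : ∀ x ∈ l i, x ≠ Y.source := by
    rintro x hx rfl
    exact hu (((hl i).mem_iff _).1 hx)
  rw [seriesBlock, List.filter_congr (q := fun x => x ≠ (X i).sink)
    (fun x hx => by simp [hmem x hx])]
  rw [hr] at hn ⊢
  simp only [List.nodup_cons, List.mem_cons, not_or] at hn
  rw [List.filter_cons_of_pos (by simpa using hn.1.1), List.filter_cons_of_neg (by simp),
    List.filter_eq_self.2]
  rintro x hx
  simp only [ne_eq, decide_not, Bool.not_eq_eq_eq_not, Bool.not_true, decide_eq_false_iff_not]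
  rintro rfl
  exact hn.2.1 hx

theorem IsSeriesComposition.length_seriesBlock (h : IsSeriesComposition X Y)
    (hl : ∀ i, Enumerates (l i) (X i)) (i : Fin m) :
    (seriesBlock Y.source l (fun i => (X i).sink) i).length + 1 + (if (i : ℕ) = 0 then 1 else 0) =
      (X i).card := by
  obtain ⟨r, hr⟩ := (hl i).exists_tail
  rw [← (hl i).length_eq]
  by_cases hi : (i : ℕ) = 0
  · rw [h.seriesBlock_zero hl hi hr, hr, if_pos hi]
    rfl
  · rw [h.seriesBlock_of_ne_zero hl hi hr, hr, if_neg hi]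
    rfl

/-- The length of a layout, for an arbitrary choice of `a`. -/
theorem IsSeriesComposition.card_eq (h : IsSeriesComposition X Y)
    (hl : ∀ i, Enumerates (l i) (X i)) :
    Y.card = 2 + ∑ i, (seriesBlock Y.source l (fun i => (X i).sink) i).length := by
  have hm := h.two_le
  have a : Fin m := ⟨0, by omega⟩
  rw [← (h.enumerates hl a).length_eq, seriesLayout_eq,
    ← sumBelow_add_add_sumAbove _ a, sumBelow, sumAbove]
  generalize seriesBlock Y.source l (fun i => (X i).sink) = b
  have h1 := length_flatMap_filter_finRange b fun i => a < i
  rw [← List.length_reverse, List.reverse_flatMap] at h1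
  simp only [List.length_cons, List.length_append, length_flatMap_filter_finRange]
  rw [show (fun i => (b i).reverse) = List.reverse ∘ b from rfl, h1]
  omega

theorem IsSeriesComposition.sum_card (h : IsSeriesComposition X Y)
    (hl : ∀ i, Enumerates (l i) (X i)) : ∑ i, (X i).card + 1 = Y.card + m := by
  have hm := h.two_le
  have hs : ∑ i : Fin m, (if (i : ℕ) = 0 then 1 else 0) = 1 := by
    rw [Finset.sum_eq_single_of_mem (⟨0, by omega⟩ : Fin m) (Finset.mem_univ _)]
    · simp
    · intro i _ hi
      exact if_neg fun h => hi (Fin.ext h)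
  simp only [h.card_eq hl, ← h.length_seriesBlock hl, Finset.sum_add_distrib, Finset.sum_const,
    Finset.card_univ, Fintype.card_fin, smul_eq_mul, mul_one, hs]
  omega

/-- The positions of the vertices of a block in a series layout. -/
theorem IsSeriesComposition.idxOf_seriesLayout (h : IsSeriesComposition X Y)
    (hl : ∀ i, Enumerates (l i) (X i)) (a i : Fin m) (b : Fin m → List α)
    (hb : b = seriesBlock Y.source l (fun i => (X i).sink)) {x : α} (hx : x ∈ b i) :
    (i < a ∧ (seriesLayout Y.source Y.sink l (fun i => (X i).sink) a).idxOf x =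
      2 + sumBelow (fun i => (b i).length) i + (b i).idxOf x) ∨
    (i = a ∧ (seriesLayout Y.source Y.sink l (fun i => (X i).sink) a).idxOf x =
      2 + sumBelow (fun i => (b i).length) a + sumAbove (fun i => (b i).length) a +
        (b i).idxOf x) ∨
    (a < i ∧ (seriesLayout Y.source Y.sink l (fun i => (X i).sink) a).idxOf x + (b i).idxOf x + 1 =
      2 + sumBelow (fun i => (b i).length) a + sumAbove (fun i => (b i).length) i +
        (b i).length) := by
  have hd : ∀ j, j ≠ i → x ∉ b j := by
    subst hb
    exact fun j hj hxj => h.seriesBlock_disjoint hl hj hxj hx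
  have hu : Y.source ≠ x := by
    subst hb
    rw [mem_seriesBlock hl] at hx
    exact hx.2.2.symm
  have hv : Y.sink ≠ x := by
    subst hb
    rintro rfl
    exact h.sink_notMem_seriesBlock hl i hx
  have hn : (b i).Nodup := by
    subst hb
    exact (hl i).nodup.filter _
  rw [seriesLayout_eq, ← hb, List.idxOf_cons_ne _ hu, List.idxOf_cons_ne _ hv]
  have hlen1 := length_flatMap_filter_finRange b fun i => i < a
  have hlen2 := length_flatMap_filter_finRange b fun i => a < i
  rw [← List.length_reverse, List.reverse_flatMap] at hlen2
  change List.length (List.flatMap (fun i => (b i).reverse) _) = _ at hlen2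
  have hsorted : (List.finRange m).Pairwise (· < ·) := List.pairwise_lt_finRange m
  have hnotmem : ∀ s : List (Fin m), i ∉ s → x ∉ s.flatMap b := by
    intro s hs hxs
    obtain ⟨j, hj, hxj⟩ := List.mem_flatMap.1 hxs
    exact hd j (by rintro rfl; exact hs hj) hxj
  have hnotmem' : ∀ s : List (Fin m), i ∉ s → x ∉ s.flatMap fun i => (b i).reverse := by
    intro s hs hxs
    obtain ⟨j, hj, hxj⟩ := List.mem_flatMap.1 hxs
    exact hd j (by rintro rfl; exact hs hj) (List.mem_reverse.1 hxj)
  rcases lt_trichotomy i a with hia | rfl | hia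
  · refine Or.inl ⟨hia, ?_⟩
    have hi : i ∈ (List.finRange m).filter fun i => i < a := by simpa using hia
    rw [List.append_assoc, List.idxOf_append_of_mem (List.mem_flatMap.2 ⟨i, hi, hx⟩),
      idxOf_flatMap_of_pairwise (fun i j => lt_asymm) (hsorted.filter _) hi hx
        (fun k _ hk => hd k hk), sumBelow]
    have : ((List.finRange m).filter fun i => i < a).toFinset.filter (fun k => k < i) =
        Finset.univ.filter fun k => k < i := by
      ext k
      simp only [Finset.mem_filter, List.mem_toFinset, List.mem_filter, List.mem_finRange,
        true_and, decide_eq_true_eq, Finset.mem_univ, and_iff_right_iff_imp]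
      exact fun hk => hk.trans hia
    rw [this]
    omega
  · refine Or.inr (Or.inl ⟨rfl, ?_⟩)
    rw [List.append_assoc, List.idxOf_append_of_notMem (hnotmem _ (by simp)),
      List.idxOf_append_of_notMem (hnotmem' _ (by simp)), hlen1, hlen2, sumBelow, sumAbove]
    omega
  · refine Or.inr (Or.inr ⟨hia, ?_⟩)
    have hi : i ∈ ((List.finRange m).filter fun i => a < i).reverse := by simpa using hia
    have hx' : x ∈ (b i).reverse := List.mem_reverse.2 hx
    -- Indices from the left and from the right add up to the length minus one; written without
    -- subtraction.
    have hrev : (b i).reverse.idxOf x + (b i).idxOf x + 1 = (b i).length := by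
      obtain ⟨p, q, hpq⟩ := List.append_of_mem hx
      rw [hpq] at hn ⊢
      rw [List.nodup_append', List.nodup_cons] at hn
      have hp : x ∉ p := fun hxp => hn.2.2 hxp (by simp)
      rw [List.idxOf_append_of_notMem hp, List.idxOf_cons_self, List.reverse_append,
        List.reverse_cons, List.append_assoc, List.singleton_append,
        List.idxOf_append_of_notMem (by simpa using hn.2.1.1), List.idxOf_cons_self]
      simp only [List.length_reverse, List.length_append, List.length_cons]
      omega
    rw [List.append_assoc, List.idxOf_append_of_notMem (hnotmem _ (by simpa using hia.le)),
      List.idxOf_append_of_mem (List.mem_flatMap.2 ⟨i, hi, hx'⟩),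
      idxOf_flatMap_of_pairwise (r := fun i j => j < i) (fun i j => lt_asymm)
        (List.pairwise_reverse.2 (hsorted.filter _)) hi hx'
        (fun k _ hk => by rw [List.mem_reverse]; exact hd k hk), hlen1, sumBelow, sumAbove]
    have : ((List.finRange m).filter fun i => a < i).reverse.toFinset.filter (fun k => i < k) =
        Finset.univ.filter fun k => i < k := by
      ext k
      simp only [Finset.mem_filter, List.mem_toFinset, List.mem_reverse, List.mem_filter,
        List.mem_finRange, true_and, decide_eq_true_eq, Finset.mem_univ, and_iff_right_iff_imp]
      exact fun hk => hia.trans hk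
    rw [this]
    simp only [List.length_reverse]
    omega

end UpperBound

/-- Allows a conditional to be generalized to a variable with two cases, so that linear arithmetic
can treat it as an atom. -/
theorem ite_cases {γ : Type*} (c : Prop) [Decidable c] (x y : γ) :
    (c ∧ (if c then x else y) = x) ∨ (¬ c ∧ (if c then x else y) = y) := by
  split_ifs with h <;> simp [h]

section UpperBound

variable [DecidableEq α] {m : ℕ} {X : Fin m → TTG α β} {Y : TTG α β} {l : Fin m → List α}

/-- In a series layout only the edges at the terminals of the children become longer. -/
theorem IsSeriesComposition.edgeLength_le (h : IsSeriesComposition X Y)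
    (hl : ∀ i, Enumerates (l i) (X i)) (a : Fin m) (n : Fin m → ℕ)
    (hn : n = fun i => (seriesBlock Y.source l (fun i => (X i).sink) i).length) {i : Fin m} {e : β}
    (he : e ∈ (X i).graph.edgeSet) [DecidablePred ((X i).graph.Inc e)] :
    edgeLength Y.graph (position (seriesLayout Y.source Y.sink l (fun i => (X i).sink) a)) e ≤
      edgeLength (X i).graph (position (l i)) e +
        ((if (X i).graph.Inc e (X i).source then 1 else 0) *
            (if i = a then Y.card - (X a).card else 0) +
          (if (X i).graph.Inc e (X i).sink then 1 else 0) *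
            (if i = a then Y.card - (X a).card else
              (X i).card - 1 + (if (i : ℕ) + 1 = a then sumAbove n a else 0) +
                (if (i : ℕ) + 1 = m then sumBelow n a else 0))) := by
  have hcardY := h.card_eq hl
  have hlenb := h.length_seriesBlock hl
  have hidx := fun i {x : α} => h.idxOf_seriesLayout hl a i _ rfl (x := x)
  rw [← sumBelow_add_add_sumAbove _ a] at hcardY
  rw [← hn] at hidx hcardY
  have hsourceY : (seriesLayout Y.source Y.sink l (fun i => (X i).sink) a).idxOf Y.source = 0 := by
    rw [seriesLayout_eq, List.idxOf_cons_self]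
  have hsinkY : (seriesLayout Y.source Y.sink l (fun i => (X i).sink) a).idxOf Y.sink = 1 := by
    rw [seriesLayout_eq, List.idxOf_cons_ne _ Y.source_ne_sink, List.idxOf_cons_self]
  choose r hr using fun i => (hl i).exists_tail
  have hblock : ∀ i, seriesBlock Y.source l (fun i => (X i).sink) i =
      if (i : ℕ) = 0 then r i else (X i).source :: r i := by
    intro i
    split_ifs with hi
    · exact h.seriesBlock_zero hl hi (hr i)
    · exact h.seriesBlock_of_ne_zero hl hi (hr i)
  have hnb : ∀ i, (seriesBlock Y.source l (fun i => (X i).sink) i).length = n i := fun i => by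
    rw [hn]
  simp only [hnb] at hidx hlenb
  generalize seriesBlock Y.source l (fun i => (X i).sink) = b at *
  generalize seriesLayout Y.source Y.sink l (fun i => (X i).sink) a = L at *
  have hsource : ∀ i : Fin m, ((i : ℕ) = 0 ∧ L.idxOf (X i).source = 0) ∨
      ((i : ℕ) ≠ 0 ∧ (X i).source ∈ b i ∧ (b i).idxOf (X i).source = 0) := by
    intro i
    by_cases hi : (i : ℕ) = 0
    · exact Or.inl ⟨hi, by rw [← h.source_eq i hi, hsourceY]⟩
    · refine Or.inr ⟨hi, ?_⟩
      rw [hblock i, if_neg hi]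
      simp
  obtain ⟨x, y, hxy⟩ := Graph.exists_isLink_of_mem_edgeSet he
  rw [edgeLength_position _ hxy, edgeLength_position _ (h.union.isLink hxy)]
  have hne := (X i).source_ne_sink
  have hclass : ∀ z ∈ (X i).graph.vertexSet,
      (z = (X i).source ∧ (l i).idxOf z = 0) ∨ (z = (X i).sink ∧ (l i).idxOf z = 1) ∨
      (z ∈ b i ∧ (l i).idxOf z + (if (i : ℕ) = 0 then 0 else 1) = (b i).idxOf z + 2 ∧
        (b i).idxOf z < n i) := by
    intro z hz
    by_cases hzu : z = (X i).source
    · exact Or.inl ⟨hzu, by rw [hr i, hzu, List.idxOf_cons_self]⟩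
    refine Or.inr ?_
    by_cases hzv : z = (X i).sink
    · exact Or.inl ⟨hzv, by rw [hr i, hzv, List.idxOf_cons_ne _ hne, List.idxOf_cons_self]⟩
    · have hzr : z ∈ r i := by
        have := ((hl i).mem_iff z).2 hz
        rw [hr i] at this
        simpa [hzu, hzv] using this
      have hzb : z ∈ b i := by
        rw [hblock i]
        split_ifs
        exacts [hzr, List.mem_cons_of_mem _ hzr]
      refine Or.inr ⟨hzb, ?_, hnb i ▸ List.idxOf_lt_length_of_mem hzb⟩
      rw [hr i, List.idxOf_cons_ne _ (Ne.symm hzu), List.idxOf_cons_ne _ (Ne.symm hzv), hblock i]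
      split_ifs
      · rfl
      · rw [List.idxOf_cons_ne _ (Ne.symm hzu)]
  -- The sink of a child is not in its own block: it is the vertex at index 1 or the head of the
  -- next block.
  have hsink : ((i : ℕ) + 1 = m ∧ L.idxOf (X i).sink = 1) ∨
      ∃ j : Fin m, (i : ℕ) + 1 = j ∧ (X i).sink ∈ b j ∧ (b j).idxOf (X i).sink = 0 := by
    by_cases hi : (i : ℕ) + 1 = m
    · exact Or.inl ⟨hi, by rw [← h.sink_eq i hi, hsinkY]⟩
    · refine Or.inr ⟨⟨i + 1, by omega⟩, rfl, ?_⟩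
      rw [h.sink_eq_source i ⟨i + 1, by omega⟩ rfl, hblock, if_neg (by simp)]
      simp
  have hincx := hxy.inc_left
  have hincy := hxy.inc_right
  have hcx := hclass x hxy.left_mem
  have hcy := hclass y hxy.right_mem
  have hrest : Y.card - (X a).card =
      sumBelow n a + sumAbove n a + if (a : ℕ) = 0 then 0 else 1 := by
    have := hlenb a
    rw [hnb] at hcardY
    split_ifs at this ⊢ <;> omega
  have hcard := hlenb i
  have hs : ((i : ℕ) = 0 ∧ L.idxOf (X i).source = 0) ∨ ((i : ℕ) ≠ 0 ∧
      ((i < a ∧ L.idxOf (X i).source = 2 + sumBelow n i) ∨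
      (i = a ∧ L.idxOf (X i).source = 2 + sumBelow n a + sumAbove n a) ∨
      (a < i ∧ L.idxOf (X i).source + 1 = 2 + sumBelow n a + sumAbove n i + n i))) := by
    rcases hsource i with h0 | ⟨h0, h1, h2⟩
    · exact Or.inl h0
    · refine Or.inr ⟨h0, ?_⟩
      simpa only [h2, add_zero] using hidx i h1
  have ht : ((i : ℕ) + 1 = m ∧ L.idxOf (X i).sink = 1) ∨ ∃ j : Fin m, (i : ℕ) + 1 = j ∧
      ((j < a ∧ L.idxOf (X i).sink = 2 + sumBelow n j) ∨
      (j = a ∧ L.idxOf (X i).sink = 2 + sumBelow n a + sumAbove n a) ∨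
      (a < j ∧ L.idxOf (X i).sink + 1 = 2 + sumBelow n a + sumAbove n j + n j)) := by
    rcases hsink with h0 | ⟨j, h0, h1, h2⟩
    · exact Or.inl h0
    · refine Or.inr ⟨j, h0, ?_⟩
      simpa only [h2, add_zero] using hidx j h1
  have hclass' : ∀ z, (z = (X i).source ∧ (l i).idxOf z = 0) ∨
      (z = (X i).sink ∧ (l i).idxOf z = 1) ∨
      (z ∈ b i ∧ (l i).idxOf z + (if (i : ℕ) = 0 then 0 else 1) = (b i).idxOf z + 2 ∧
        (b i).idxOf z < n i) →
      (z = (X i).source ∧ (l i).idxOf z = 0) ∨ (z = (X i).sink ∧ (l i).idxOf z = 1) ∨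
      ∃ k, (l i).idxOf z + (if (i : ℕ) = 0 then 0 else 1) = k + 2 ∧ k < n i ∧
        ((i < a ∧ L.idxOf z = 2 + sumBelow n i + k) ∨
        (i = a ∧ L.idxOf z = 2 + sumBelow n a + sumAbove n a + k) ∨
        (a < i ∧ L.idxOf z + k + 1 = 2 + sumBelow n a + sumAbove n i + n i)) :=
    fun z hz => hz.imp_right (Or.imp_right fun ⟨h1, h2, h3⟩ => ⟨_, h2, h3, hidx i h1⟩)
  replace hcx := hclass' x hcx
  replace hcy := hclass' y hcy
  clear hclass' hidx hsource hsink hclass hblock hcardY hlenb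
  rw [hrest]
  have hδ := ite_cases ((i : ℕ) = 0) 0 1
  generalize (if (i : ℕ) = 0 then 0 else 1) = δ at hδ hcx hcy
  have hδ' := ite_cases ((i : ℕ) = 0) 1 0
  generalize (if (i : ℕ) = 0 then 1 else 0) = δ' at hδ' hcard
  have hε := ite_cases ((a : ℕ) = 0) 0 1
  generalize (if (a : ℕ) = 0 then 0 else 1) = ε at hε ⊢
  clear hrest
  have hi0 := i.2
  have ha0 := a.2
  have h3 : (i : ℕ) = 0 → sumBelow n i = 0 := by
    intro h0
    rw [sumBelow, Finset.sum_eq_zero]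
    intro k hk
    simp only [Finset.mem_filter, Finset.mem_univ, true_and, Fin.lt_def] at hk
    omega
  -- Before `a`, the sink of a child stands right after its block, unless the next child is `a`;
  -- then the flipped blocks intervene. After `a`, the flipped block ends with its source, and the
  -- sink stands just to the left of the block, unless the child is last; then its sink is at index
  -- 1 and the blocks before `a` intervene. For `a` itself a growth by all vertices outside it is
  -- allowed at both terminals.
  rcases lt_trichotomy i a with hia | hia | hia
  · have h1 := sumBelow_add_le n hia
    have hia' := Fin.lt_def.1 hia
    have hia2 := hia.ne
    have hia3 := hia.asymm
    replace hs : ((i : ℕ) = 0 ∧ L.idxOf (X i).source = 0) ∨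
        ((i : ℕ) ≠ 0 ∧ L.idxOf (X i).source = 2 + sumBelow n i) := by
      simpa only [hia, hia2, hia3, true_and, false_and, or_false] using hs
    replace ht : ((i : ℕ) + 1 = a ∧ L.idxOf (X i).sink = 2 + sumBelow n i + n i + sumAbove n a) ∨
        ((i : ℕ) + 1 < a ∧ L.idxOf (X i).sink = 2 + sumBelow n i + n i) := by
      rcases ht with ht | ⟨j, hj, ht⟩
      · omega
      · have h2 := sumBelow_succ n hj
        rcases ht with ⟨hja, ht⟩ | ⟨rfl, ht⟩ | ⟨hja, ht⟩
        · rw [Fin.lt_def] at hja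
          omega
        · omega
        · rw [Fin.lt_def] at hja
          omega
    simp only [hia, hia2, hia3, true_and, false_and, or_false] at hcx hcy
    simp only [if_neg hia2, mul_zero, zero_add]
    have hC := ite_cases ((i : ℕ) + 1 = a) (sumAbove n a) 0
    generalize (if (i : ℕ) + 1 = a then sumAbove n a else 0) = C at hC ⊢
    have hC' := ite_cases ((i : ℕ) + 1 = m) (sumBelow n a) 0
    generalize (if (i : ℕ) + 1 = m then sumBelow n a else 0) = C' at hC' ⊢
    rcases hcx with ⟨rfl, hx⟩ | ⟨rfl, hx⟩ | ⟨k, hx, hk, hx'⟩ <;>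
    rcases hcy with ⟨rfl, hy⟩ | ⟨rfl, hy⟩ | ⟨k', hy, hk', hy'⟩ <;>
    (try simp only [hincx, hincy, if_true, one_mul]) <;>
    omega
  · subst hia
    simp only [lt_irrefl, true_and, false_and, or_false, false_or] at hcx hcy hs
    have ht' : ((i : ℕ) + 1 = m ∧ L.idxOf (X i).sink = 1 ∧ sumAbove n i = 0) ∨
        L.idxOf (X i).sink + 1 = 2 + sumBelow n i + sumAbove n i := by
      rcases ht with ⟨hj, ht⟩ | ⟨j, hj, ht⟩
      · exact Or.inl ⟨hj, ht, sumAbove_last n hj⟩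
      · have h2 := sumAbove_succ n hj
        rw [Fin.lt_def, Fin.lt_def, Fin.ext_iff] at ht
        omega
    simp only [if_true]
    clear ht
    rcases hcx with ⟨rfl, hx⟩ | ⟨rfl, hx⟩ | ⟨k, hx, hk, hx'⟩ <;>
    rcases hcy with ⟨rfl, hy⟩ | ⟨rfl, hy⟩ | ⟨k', hy, hk', hy'⟩ <;>
    (try simp only [hincx, hincy, if_true, one_mul]) <;>
    omega
  · have h1 := sumAbove_add_le n hia
    have hia' := Fin.lt_def.1 hia
    have hia2 := hia.ne'
    have hia3 := hia.asymm
    replace hs : L.idxOf (X i).source + 1 = 2 + sumBelow n a + sumAbove n i + n i := by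
      simp only [hia, hia2, hia3, true_and, false_and, false_or] at hs
      omega
    have ht' : ((i : ℕ) + 1 = m ∧ L.idxOf (X i).sink = 1 ∧ sumAbove n i = 0) ∨
        ((i : ℕ) + 1 ≠ m ∧ L.idxOf (X i).sink + 1 = 2 + sumBelow n a + sumAbove n i) := by
      rcases ht with ⟨hj, ht⟩ | ⟨j, hj, ht⟩
      · exact Or.inl ⟨hj, ht, sumAbove_last n hj⟩
      · have h2 := sumAbove_succ n hj
        rw [Fin.lt_def, Fin.lt_def, Fin.ext_iff] at ht
        omega
    clear ht
    simp only [hia, hia2, hia3, true_and, false_and, false_or] at hcx hcy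
    simp only [if_neg hia2, mul_zero, zero_add]
    have hC := ite_cases ((i : ℕ) + 1 = a) (sumAbove n a) 0
    generalize (if (i : ℕ) + 1 = a then sumAbove n a else 0) = C at hC ⊢
    have hC' := ite_cases ((i : ℕ) + 1 = m) (sumBelow n a) 0
    generalize (if (i : ℕ) + 1 = m then sumBelow n a else 0) = C' at hC' ⊢
    rcases hcx with ⟨rfl, hx⟩ | ⟨rfl, hx⟩ | ⟨k, hx, hk, hx'⟩ <;>
    rcases hcy with ⟨rfl, hy⟩ | ⟨rfl, hy⟩ | ⟨k', hy, hk', hy'⟩ <;>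
    (try simp only [hincx, hincy, if_true, one_mul]) <;>
    omega

end UpperBound

theorem sum_ite_eq_add {m : ℕ} (a : Fin m) (K : ℕ) (f : Fin m → ℕ) :
    ∑ i, (if i = a then K else f i) + f a = K + ∑ i, f i := by
  have : ∑ i, ((if i = a then K else f i) + if i = a then f i else 0) =
      ∑ i, ((if i = a then K else 0) + f i) :=
    Finset.sum_congr rfl fun i _ => by split_ifs <;> simp
  simpa [Finset.sum_add_distrib] using this

section UpperBound

variable [DecidableEq α]

theorem IsSeriesComposition.sum_edgeLength_le {m : ℕ} {X : Fin m → TTG α β} {Y : TTG α β}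
    {l : Fin m → List α} (h : IsSeriesComposition X Y) (hX : ∀ i, (X i).IsGood)
    (hl : ∀ i, Enumerates (l i) (X i)) (a : Fin m) {D : ℕ} (hD : ∀ i w, (X i).deg w ≤ D) :
    ∑ e ∈ Y.edges,
      edgeLength Y.graph (position (seriesLayout Y.source Y.sink l (fun i => (X i).sink) a)) e ≤
      ∑ i, ∑ e ∈ (X i).edges, edgeLength (X i).graph (position (l i)) e +
        4 * D * (Y.card - (X a).card) := by
  classical
  obtain ⟨n, hn⟩ : ∃ n : Fin m → ℕ,
    n = fun i => (seriesBlock Y.source l (fun i => (X i).sink) i).length := ⟨_, rfl⟩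
  have hcardY := h.card_eq hl
  have hlenb := h.length_seriesBlock hl a
  rw [← sumBelow_add_add_sumAbove _ a, ← hn] at hcardY
  rw [show (seriesBlock Y.source l (fun i => (X i).sink) a).length = n a by rw [hn]]
    at hlenb hcardY
  have hsum := h.sum_card hl
  have hpos : ∀ i, (X i).card = (X i).card - 1 + 1 := by
    intro i
    have := h.length_seriesBlock hl i
    omega
  have hsum' : ∑ i, ((X i).card - 1) + m = ∑ i, (X i).card := by
    conv_rhs => rw [Finset.sum_congr rfl fun i _ => hpos i]
    simp [Finset.sum_add_distrib]
  set K := Y.card - (X a).card with hK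
  have hite := sum_ite_eq_add a K fun i => (X i).card - 1
  have hAB : sumAbove n a + sumBelow n a ≤ K := by
    split_ifs at hlenb <;> omega
  have hite2 := sum_ite_val_eq_le (fun i : Fin m => (i : ℕ) + 1)
    (fun i j hij => Fin.ext (Nat.succ_injective hij)) a (sumAbove n a)
  have hite3 := sum_ite_val_eq_le (fun i : Fin m => (i : ℕ) + 1)
    (fun i j hij => Fin.ext (Nat.succ_injective hij)) m (sumBelow n a)
  -- The four summands: `K` for each terminal of child `a`; the numbers `(X i).card - 1` over `i ≠
  -- a`, which add up to `K` because merged vertices are counted once; and the two intervening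
  -- stretches, together at most `K`.
  have hcoef : ∑ i, ((if i = a then K else 0) + ((if i = a then K else (X i).card - 1) +
      (if (i : ℕ) + 1 = a then sumAbove n a else 0) +
        (if (i : ℕ) + 1 = m then sumBelow n a else 0))) ≤ 4 * K := by
    simp only [Finset.sum_add_distrib, Finset.sum_ite_eq', Finset.mem_univ, if_true]
    have := hpos a
    omega
  calc _ ≤ ∑ i, (∑ e ∈ (X i).edges, edgeLength (X i).graph (position (l i)) e +
        D * ((if i = a then K else 0) + ((if i = a then K else (X i).card - 1) +
          (if (i : ℕ) + 1 = a then sumAbove n a else 0) +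
            (if (i : ℕ) + 1 = m then sumBelow n a else 0)))) := by
        rw [h.union.sum_edges hX]
        refine Finset.sum_le_sum fun i _ => ?_
        refine (Finset.sum_le_sum fun e he =>
          h.edgeLength_le hl a n hn ((hX i).mem_edges.1 he)).trans ?_
        rw [Finset.sum_add_distrib, Finset.sum_add_distrib, ← Finset.sum_mul, ← Finset.sum_mul,
          mul_add]
        refine Nat.add_le_add_left (Nat.add_le_add ?_ ?_) _
        · refine Nat.mul_le_mul ?_ le_rfl
          exact hD i (X i).source
        · refine Nat.mul_le_mul ?_ ?_
          · exact hD i (X i).sink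
          · split_ifs <;> omega
    _ ≤ _ := by
        rw [Finset.sum_add_distrib, ← Finset.mul_sum, mul_comm 4 D, mul_assoc]
        exact Nat.add_le_add_left (Nat.mul_le_mul_left D hcoef) _

/-- The upper bound on the cost of the computed arrangement. -/
theorem SPGAA.sum_edgeLength_le {T : SPTree α β} {l : List α} (h : SPGAA T l) (hT : T.IsSPTree)
    {D : ℕ} (hD : ∀ w, T.ttg.deg w ≤ D) :
    ∑ e ∈ T.ttg.edges, edgeLength T.ttg.graph (position l) e ≤
      2 * T.ttg.edges.card + 4 * D * T.load := by
  induction h with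
  | leaf X v e h => exact h.sum_edgeLength_le.trans (Nat.le_add_right _ _)
  | @series X m c l hl a ha ih =>
    have hgood := fun i => (hT.2 i).isGood
    have hdeg : ∀ i w, (c i).ttg.deg w ≤ D := fun i w =>
      (hT.1.union.deg_le hgood i w).trans (hD w)
    refine (hT.1.sum_edgeLength_le hgood (fun i => (hl i).enumerates (hT.2 i)) a hdeg).trans ?_
    have h1 := Finset.sum_le_sum fun i (_ : i ∈ Finset.univ) => ih i (hT.2 i) (hdeg i)
    rw [Finset.sum_add_distrib, ← Finset.mul_sum, ← Finset.mul_sum,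
      ← hT.1.union.card_edges hgood] at h1
    rw [SPTree.load, sup_eq_of_forall_le ha, mul_add]
    simp only [SPTree.ttg] at *
    omega
  | @parallel X m c l hl a ha others ho ih =>
    have hgood := fun i => (hT.2 i).isGood
    have hdeg : ∀ i w, (c i).ttg.deg w ≤ D := fun i w =>
      (hT.1.union.deg_le hgood i w).trans (hD w)
    refine (hT.1.sum_edgeLength_le hgood (fun i => (hl i).enumerates (hT.2 i)) ho).trans ?_
    have h1 := Finset.sum_le_sum fun i (_ : i ∈ Finset.univ) => ih i (hT.2 i) (hdeg i)
    rw [Finset.sum_add_distrib, ← Finset.mul_sum, ← Finset.mul_sum,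
      ← hT.1.union.card_edges hgood] at h1
    -- A P-node needs only the factor 2D; the factor 4D comes from the S-nodes.
    have h2 : (X.deg X.source + X.deg X.sink) * (X.card - (c a).ttg.card) ≤
        4 * D * (X.card - (c a).ttg.card) := by
      have h3 : X.deg X.source ≤ D := hD X.source
      have h4 : X.deg X.sink ≤ D := hD X.sink
      exact Nat.mul_le_mul_right _ (by omega)
    rw [SPTree.load, sup_eq_of_forall_le ha, mul_add]
    simp only [SPTree.ttg] at *
    omega

end UpperBound

/-! ### Numbers of vertices and edges -/

theorem IsPathAlong.card_edges {X : TTG α β} {k : ℕ} {v : Fin (k + 1) → α} {e : Fin k → β}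
    (h : IsPathAlong X v e) : X.edges.card = k := by
  rw [TTG.edges, card_finsetOf h.isGood.finite_edges, h.edgeSet_eq, ← Set.image_univ,
    Set.ncard_image_of_injective _ h.edge_injective, Set.ncard_univ, Nat.card_fin]

theorem IsPathAlong.card_verts {X : TTG α β} {k : ℕ} {v : Fin (k + 1) → α} {e : Fin k → β}
    (h : IsPathAlong X v e) : X.card = k + 1 := by
  rw [TTG.card, h.vertexSet_eq, ← Set.image_univ,
    Set.ncard_image_of_injective _ h.vertex_injective, Set.ncard_univ, Nat.card_fin]

theorem TTG.two_le_card {X : TTG α β} (hX : X.IsGood) : 2 ≤ X.card := by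
  classical
  rw [← hX.card_verts, ← Finset.card_pair X.source_ne_sink]
  refine Finset.card_le_card fun x hx => ?_
  rw [hX.mem_verts]
  rcases Finset.mem_insert.1 hx with rfl | hx
  · exact X.source_mem
  · rw [Finset.mem_singleton.1 hx]
    exact X.sink_mem

theorem SPTree.IsSPTree.card_le {T : SPTree α β} (hT : T.IsSPTree) :
    T.ttg.card ≤ T.ttg.edges.card + 1 := by
  classical
  induction T with
  | leaf k X =>
    obtain ⟨v, e, h⟩ := hT
    exact (h.card_verts.trans (by rw [ttg, h.card_edges])).le
  | @series X m c ih =>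
    -- Arrangements of the children serve only as enumerations of their vertices, for the counting
    -- identity `sum_card`.
    choose l hl using fun i => (hT.2 i).exists_arrangement
    have h1 := hT.1.sum_card fun i => (hl i).enumerates (hT.2 i)
    have h2 := Finset.sum_le_sum fun i (_ : i ∈ Finset.univ) => ih i (hT.2 i)
    rw [Finset.sum_add_distrib, ← hT.1.union.card_edges fun i => (hT.2 i).isGood] at h2
    simp only [Finset.sum_const, Finset.card_univ, Fintype.card_fin, smul_eq_mul, mul_one] at h2
    simp only [ttg]
    omega
  | @parallel X m c ih =>
    choose l hl using fun i => (hT.2 i).exists_arrangement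
    have h1 := hT.1.sum_card fun i => (hl i).enumerates (hT.2 i)
    have h2 := Finset.sum_le_sum fun i (_ : i ∈ Finset.univ) => ih i (hT.2 i)
    rw [Finset.sum_add_distrib, ← hT.1.union.card_edges fun i => (hT.2 i).isGood] at h2
    simp only [Finset.sum_const, Finset.card_univ, Fintype.card_fin, smul_eq_mul, mul_one] at h2
    have hm := hT.1.two_le
    simp only [ttg]
    omega

/-! ### Lower bound: crossings -/

/-- The edge `e` passes over the vertex `z`. -/
def TTG.Crosses (X : TTG α β) (π : α → ℕ) (e : β) (z : α) : Prop :=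
  ∃ x y, X.graph.IsLink e x y ∧ π x < π z ∧ π z < π y

/-- The vertex `z` does not belong to `X`, but `X` has vertices on both sides of `z`. -/
def TTG.Covers (X : TTG α β) (π : α → ℕ) (z : α) : Prop :=
  z ∉ X.graph.vertexSet ∧ (∃ p ∈ X.graph.vertexSet, π p < π z) ∧ ∃ q ∈ X.graph.vertexSet, π z < π q

open Classical in
/-- The number of pairs of an edge and a vertex of `X` below it. -/
noncomputable def TTG.crossings (X : TTG α β) (π : α → ℕ) : ℕ :=
  ∑ e ∈ X.edges, (X.verts.filter (X.Crosses π e)).card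

open Classical in
/-- The vertices of `Y` that are covered by some `X i`. -/
noncomputable def coveredVerts {m : ℕ} (X : Fin m → TTG α β) (Y : TTG α β) (π : α → ℕ) : Finset α :=
  Y.verts.filter fun z => ∃ i, (X i).Covers π z

/-- Without such an edge the vertices left of `z` would be closed under adjacency, against
connectedness. -/
theorem TTG.IsGood.exists_crosses {X : TTG α β} (hX : X.IsGood) {π : α → ℕ} {z : α}
    (hz : X.Covers π z) (hπ : ∀ x ∈ X.graph.vertexSet, π x ≠ π z) :
    ∃ e ∈ X.edges, X.Crosses π e z := by
  obtain ⟨-, ⟨p, hp, hpz⟩, q, hq, hzq⟩ := hz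
  by_contra! hno
  have := hX.connected {x | π x < π z} (fun e x y hxy hx => ?_) p hp hpz q hq
  · exact this.asymm hzq
  · by_contra hy
    refine hno e (hX.mem_edges.2 hxy.edge_mem) ⟨x, y, hxy, hx, ?_⟩
    have := hπ y hxy.right_mem
    simp only [Set.mem_ofPred_eq] at hy
    omega

/-- The crossings of a part involve only its own vertices. A covered vertex adds a crossing between
an edge of a part and a vertex outside that part, so it is new, and different covered vertices give
different crossings. -/
theorem IsEdgeDisjointUnion.sum_crossings_add_le {m : ℕ} {X : Fin m → TTG α β} {Y : TTG α β}
    (h : IsEdgeDisjointUnion X Y) (hX : ∀ i, (X i).IsGood) (hY : Y.IsGood) {π : α → ℕ}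
    (hπ : Set.InjOn π Y.graph.vertexSet) :
    ∑ i, (X i).crossings π + (coveredVerts X Y π).card ≤ Y.crossings π := by
  classical
  have hcov : (coveredVerts X Y π).card ≤
      ∑ i, ∑ e ∈ (X i).edges,
        (Y.verts.filter fun z => z ∉ (X i).verts ∧ (X i).Crosses π e z).card := by
    calc (coveredVerts X Y π).card ≤ (Finset.univ.biUnion fun i => (X i).edges.biUnion fun e =>
          Y.verts.filter fun z => z ∉ (X i).verts ∧ (X i).Crosses π e z).card := by
            refine Finset.card_le_card fun z hz => ?_
            rw [coveredVerts, Finset.mem_filter] at hz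
            obtain ⟨hzY, i, hi⟩ := hz
            obtain ⟨e, he, hez⟩ := (hX i).exists_crosses hi fun x hx hxz => hi.1
              (hπ (h.mem_vertexSet hx) (hY.mem_verts.1 hzY) hxz ▸ hx)
            simp only [Finset.mem_biUnion, Finset.mem_univ, true_and, Finset.mem_filter]
            exact ⟨i, e, he, hzY, fun hzi => hi.1 ((hX i).mem_verts.1 hzi), hez⟩
      _ ≤ _ := Finset.card_biUnion_le.trans (Finset.sum_le_sum fun i _ => Finset.card_biUnion_le)
  refine (Nat.add_le_add_left hcov _).trans ?_
  rw [TTG.crossings, h.sum_edges hX, ← Finset.sum_add_distrib]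
  refine Finset.sum_le_sum fun i _ => ?_
  rw [TTG.crossings, ← Finset.sum_add_distrib]
  refine Finset.sum_le_sum fun e he => ?_
  rw [← Finset.card_union_of_disjoint]
  · refine Finset.card_le_card fun z hz => ?_
    have hmono : (X i).Crosses π e z → Y.Crosses π e z :=
      fun ⟨x, y, hxy, h1, h2⟩ => ⟨x, y, h.isLink hxy, h1, h2⟩
    simp only [Finset.mem_union, Finset.mem_filter] at hz ⊢
    rcases hz with ⟨h1, h2⟩ | ⟨h1, -, h2⟩
    · exact ⟨hY.mem_verts.2 (h.mem_vertexSet ((hX i).mem_verts.1 h1)), hmono h2⟩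
    · exact ⟨h1, hmono h2⟩
  · rw [Finset.disjoint_left]
    intro z hz hz'
    simp only [Finset.mem_filter] at hz hz'
    exact hz'.2.1 hz.1

/-- The cost of an injective arrangement is at least the number of edges plus the number of
crossings. -/
theorem TTG.IsGood.card_edges_add_crossings_le {X : TTG α β} (hX : X.IsGood) {π : α → ℕ}
    (hπ : Set.InjOn π X.graph.vertexSet) :
    X.edges.card + X.crossings π ≤ ∑ e ∈ X.edges, edgeLength X.graph π e := by
  classical
  rw [Finset.card_eq_sum_ones, TTG.crossings, ← Finset.sum_add_distrib]
  refine Finset.sum_le_sum fun e he => ?_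
  obtain ⟨x, y, hxy⟩ := Graph.exists_isLink_of_mem_edgeSet (hX.mem_edges.1 he)
  wlog hlt : π x ≤ π y generalizing x y
  · exact this y x hxy.symm (by omega)
  have hne : π x ≠ π y := fun h => hX.ne_of_isLink e x y hxy (hπ hxy.left_mem hxy.right_mem h)
  -- An edge of length d has d - 1 places strictly below it, and π sends the crossed vertices
  -- injectively to them.
  have hcard : (X.verts.filter (X.Crosses π e)).card ≤ (Finset.Ioo (π x) (π y)).card := by
    refine Finset.card_le_card_of_injOn π (fun z hz => ?_) fun z hz z' hz' => ?_
    · simp only [Finset.coe_filter, Set.mem_ofPred_eq] at hz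
      obtain ⟨x', y', hxy', h1, h2⟩ := hz.2
      rw [Finset.coe_Ioo, Set.mem_Ioo]
      rcases hxy.eq_and_eq_or_eq_and_eq hxy' with ⟨rfl, rfl⟩ | ⟨rfl, rfl⟩
      · exact ⟨h1, h2⟩
      · omega
    · simp only [Finset.coe_filter, Set.mem_ofPred_eq] at hz hz'
      exact hπ (hX.mem_verts.1 hz.1) (hX.mem_verts.1 hz'.1)
  rw [Nat.card_Ioo] at hcard
  rw [edgeLength_eq π hxy]
  omega

/-! ### Lower bound: the potential -/

section Potential

open Classical in
/-- The vertices to the left of both terminals. -/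
noncomputable def TTG.leftVerts (X : TTG α β) (π : α → ℕ) : Finset α :=
  X.verts.filter fun z => π z < π X.source ∧ π z < π X.sink

open Classical in
/-- The vertices to the right of both terminals. -/
noncomputable def TTG.rightVerts (X : TTG α β) (π : α → ℕ) : Finset α :=
  X.verts.filter fun z => π X.source < π z ∧ π X.sink < π z

open Classical in
/-- The vertices strictly between the terminals. -/
noncomputable def TTG.midVerts (X : TTG α β) (π : α → ℕ) : Finset α :=
  X.verts.filter fun z =>
    π X.source < π z ∧ π z < π X.sink ∨ π X.sink < π z ∧ π z < π X.source

/-- The counting argument behind the lower bound. The part `i₁` has the leftmost vertex and the part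
`i₂` the rightmost one, and `C` is the set of the covered vertices. -/
theorem add_sum_min_card_le [DecidableEq α] {m : ℕ} {V L R M C : Finset α} {u v : α}
    {W A B : Fin m → Finset α} {i₁ i₂ : Fin m} {r : ℕ}
    (hV : ∀ z ∈ V, z = u ∨ z = v ∨ z ∈ L ∨ z ∈ R ∨ z ∈ M)
    (hr : ∀ i, r ≤ (V \ W i).card)
    (hL : ∀ z ∈ L, z ∉ C → z ∈ W i₁) (hR : ∀ z ∈ R, z ∉ C → z ∈ W i₂)
    (hA : ∀ i, ∀ z ∈ A i, z ∉ C → z ∈ L) (hB : ∀ i, ∀ z ∈ B i, z ∉ C → z ∈ R)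
    (hAW : ∀ i j, i ≠ j → ∀ z ∈ A i, z ∉ W j) (hBW : ∀ i j, i ≠ j → ∀ z ∈ B i, z ∉ W j) :
    r + ∑ i, min (A i).card (B i).card ≤
      (C ∪ M).card + 2 + ∑ i, ((A i ∪ B i) ∩ C).card + min L.card R.card := by
  have huv : ({u, v} : Finset α).card ≤ 2 := Finset.card_le_two
  -- An uncovered left vertex of a part is a left vertex of the whole and so belongs to part `i₁`.
  -- Hence the left vertices of every other part are covered.
  have hAC : ∀ i, i ≠ i₁ → A i ⊆ (A i ∪ B i) ∩ C := fun i hi z hz => by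
    refine Finset.mem_inter.2 ⟨Finset.mem_union_left _ hz, ?_⟩
    by_contra hzC
    exact hAW i i₁ hi z hz (hL z (hA i z hz hzC) hzC)
  have hBC : ∀ i, i ≠ i₂ → B i ⊆ (A i ∪ B i) ∩ C := fun i hi z hz => by
    refine Finset.mem_inter.2 ⟨Finset.mem_union_right _ hz, ?_⟩
    by_contra hzC
    exact hBW i i₂ hi z hz (hR z (hB i z hz hzC) hzC)
  -- If one part reaches both extremes, everything outside it is covered, between the terminals or a
  -- terminal. This bounds `r` without `L` and `R`, so `min L.card R.card` is free to pay for that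
  -- one part.
  by_cases h12 : i₁ = i₂
  · subst h12
    have h1 : r ≤ (C ∪ M).card + 2 := by
      refine (hr i₁).trans (le_trans (Finset.card_le_card (t := (C ∪ M) ∪ {u, v}) fun z hz => ?_)
        ((Finset.card_union_le _ _).trans (Nat.add_le_add_left huv _)))
      rw [Finset.mem_sdiff] at hz
      have := hV z hz.1
      have := hL z
      have := hR z
      simp only [Finset.mem_union, Finset.mem_insert, Finset.mem_singleton]
      tauto
    have h2 : ∑ i, min (A i).card (B i).card ≤
        ∑ i, (((A i ∪ B i) ∩ C).card + if i = i₁ then min L.card R.card else 0) := by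
      refine Finset.sum_le_sum fun i _ => ?_
      split_ifs with hi
      · have h3 : (A i).card ≤ ((A i ∪ B i) ∩ C).card + L.card := by
          refine le_trans (Finset.card_le_card fun z hz => ?_) (Finset.card_union_le _ _)
          have := hA i z hz
          simp only [Finset.mem_union, Finset.mem_inter]
          tauto
        have h4 : (B i).card ≤ ((A i ∪ B i) ∩ C).card + R.card := by
          refine le_trans (Finset.card_le_card fun z hz => ?_) (Finset.card_union_le _ _)
          have := hB i z hz
          simp only [Finset.mem_union, Finset.mem_inter]
          tauto
        omega
      · have := Finset.card_le_card (hAC i hi)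
        omega
    rw [Finset.sum_add_distrib, Finset.sum_ite_eq' Finset.univ i₁] at h2
    simp only [Finset.mem_univ, if_true] at h2
    omega
  -- Otherwise `min L.card R.card` pays for `r`: outside part `i₁` there is no uncovered vertex of
  -- `L`, and outside part `i₂` none of `R`. Every part differs from `i₁` or from `i₂`, so its
  -- smaller side is covered.
  · have h1 : r ≤ (C ∪ M).card + 2 + R.card := by
      refine (hr i₁).trans (le_trans (Finset.card_le_card (t := (C ∪ M) ∪ {u, v} ∪ R)
        fun z hz => ?_) ((Finset.card_union_le _ _).trans (Nat.add_le_add_right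
          ((Finset.card_union_le _ _).trans (Nat.add_le_add_left huv _)) _)))
      rw [Finset.mem_sdiff] at hz
      have := hV z hz.1
      have := hL z
      simp only [Finset.mem_union, Finset.mem_insert, Finset.mem_singleton]
      tauto
    have h2 : r ≤ (C ∪ M).card + 2 + L.card := by
      refine (hr i₂).trans (le_trans (Finset.card_le_card (t := (C ∪ M) ∪ {u, v} ∪ L)
        fun z hz => ?_) ((Finset.card_union_le _ _).trans (Nat.add_le_add_right
          ((Finset.card_union_le _ _).trans (Nat.add_le_add_left huv _)) _)))
      rw [Finset.mem_sdiff] at hz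
      have := hV z hz.1
      have := hR z
      simp only [Finset.mem_union, Finset.mem_insert, Finset.mem_singleton]
      tauto
    have h3 : ∑ i, min (A i).card (B i).card ≤ ∑ i, ((A i ∪ B i) ∩ C).card := by
      refine Finset.sum_le_sum fun i _ => ?_
      by_cases hi : i = i₁
      · have := Finset.card_le_card (hBC i (hi ▸ h12))
        omega
      · have := Finset.card_le_card (hAC i hi)
        omega
    omega

end Potential

section Potential

namespace TTG

variable {X : TTG α β} {π : α → ℕ} {z : α}

theorem mem_leftVerts : z ∈ X.leftVerts π ↔ z ∈ X.verts ∧ π z < π X.source ∧ π z < π X.sink := by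
  simp [leftVerts]

theorem mem_rightVerts :
    z ∈ X.rightVerts π ↔ z ∈ X.verts ∧ π X.source < π z ∧ π X.sink < π z := by
  simp [rightVerts]

theorem mem_midVerts : z ∈ X.midVerts π ↔ z ∈ X.verts ∧
    (π X.source < π z ∧ π z < π X.sink ∨ π X.sink < π z ∧ π z < π X.source) := by
  simp [midVerts]

theorem IsGood.mem_verts_cases (hX : X.IsGood) (hπ : Set.InjOn π X.graph.vertexSet)
    (hz : z ∈ X.verts) : z = X.source ∨ z = X.sink ∨ z ∈ X.leftVerts π ∨ z ∈ X.rightVerts π ∨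
      z ∈ X.midVerts π := by
  have hzX := hX.mem_verts.1 hz
  by_cases hu : z = X.source
  · exact Or.inl hu
  by_cases hv : z = X.sink
  · exact Or.inr (Or.inl hv)
  have h1 : π z ≠ π X.source := fun h => hu (hπ hzX X.source_mem h)
  have h2 : π z ≠ π X.sink := fun h => hv (hπ hzX X.sink_mem h)
  rw [mem_leftVerts, mem_rightVerts, mem_midVerts]
  simp only [hz, true_and]
  omega

/-- The left vertices, the middle vertices and the two terminals are disjoint. -/
theorem IsGood.min_add_card_midVerts_le (hX : X.IsGood) :
    min (X.leftVerts π).card (X.rightVerts π).card + (X.midVerts π).card + 2 ≤ X.card := by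
  classical
  rw [← hX.card_verts, ← Finset.card_pair X.source_ne_sink]
  refine (Nat.add_le_add_right (Nat.add_le_add_right (min_le_left _ _) _) _).trans ?_
  rw [← Finset.card_union_of_disjoint, ← Finset.card_union_of_disjoint]
  · refine Finset.card_le_card fun z hz => ?_
    simp only [Finset.mem_union, mem_leftVerts, mem_midVerts, Finset.mem_insert,
      Finset.mem_singleton] at hz
    rcases hz with (h | h) | rfl | rfl
    exacts [h.1, h.1, hX.mem_verts.2 X.source_mem, hX.mem_verts.2 X.sink_mem]
  · rw [Finset.disjoint_left]
    intro z hz hz'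
    simp only [Finset.mem_union, mem_leftVerts, mem_midVerts, Finset.mem_insert,
      Finset.mem_singleton] at hz hz'
    rcases hz' with rfl | rfl <;> omega
  · rw [Finset.disjoint_left]
    intro z hz hz'
    rw [mem_leftVerts] at hz
    rw [mem_midVerts] at hz'
    omega

end TTG

/-! ### Lower bound: the potential at parallel compositions -/

variable {m : ℕ} {X : Fin m → TTG α β} {Y : TTG α β} {π : α → ℕ} {z : α}

theorem mem_coveredVerts : z ∈ coveredVerts X Y π ↔ z ∈ Y.verts ∧ ∃ i, (X i).Covers π z := by
  simp [coveredVerts]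

/-- There are parts with the leftmost and the rightmost vertex. -/
theorem IsEdgeDisjointUnion.exists_extreme (h : IsEdgeDisjointUnion X Y) (hY : Y.IsGood)
    (π : α → ℕ) : ∃ i₁ i₂, (∃ w ∈ (X i₁).graph.vertexSet, ∀ z ∈ Y.graph.vertexSet, π w ≤ π z) ∧
      ∃ w ∈ (X i₂).graph.vertexSet, ∀ z ∈ Y.graph.vertexSet, π z ≤ π w := by
  have hne : Y.verts.Nonempty := ⟨_, hY.mem_verts.2 Y.source_mem⟩
  obtain ⟨w₁, hw₁, h₁⟩ := Y.verts.exists_min_image π hne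
  obtain ⟨w₂, hw₂, h₂⟩ := Y.verts.exists_max_image π hne
  rw [hY.mem_verts, h.vertexSet_eq] at hw₁ hw₂
  obtain ⟨i₁, hi₁⟩ := Set.mem_iUnion.1 hw₁
  obtain ⟨i₂, hi₂⟩ := Set.mem_iUnion.1 hw₂
  exact ⟨i₁, i₂, ⟨w₁, hi₁, fun z hz => h₁ z (hY.mem_verts.2 hz)⟩,
    ⟨w₂, hi₂, fun z hz => h₂ z (hY.mem_verts.2 hz)⟩⟩

theorem le_card_sdiff_verts [DecidableEq α] {X Y : TTG α β} (hX : X.IsGood) (hY : Y.IsGood) {r : ℕ}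
    (hr : r + X.card ≤ Y.card) : r ≤ (Y.verts \ X.verts).card := by
  have := Finset.le_card_sdiff X.verts Y.verts
  rw [hX.card_verts, hY.card_verts] at this
  omega

theorem sum_card_le_of_pairwise_disjoint [DecidableEq α] {A : Fin m → Finset α} {C : Finset α}
    (hA : ∀ i j, i ≠ j → ∀ z ∈ A i, z ∉ A j) (hC : ∀ i, A i ⊆ C) : ∑ i, (A i).card ≤ C.card := by
  rw [← Finset.card_biUnion fun i _ j _ hij => Finset.disjoint_left.2 (hA i j hij)]
  exact Finset.card_le_card (Finset.biUnion_subset.2 fun i _ => hC i)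

/-- All parts share both terminals, so left, right and middle mean the same for the parts and the
whole. The middle vertices of the parts can appear on the left and those of the whole are missing on
the right because all of them are covered. -/
theorem IsParallelComposition.add_sum_min_le (h : IsParallelComposition X Y)
    (hX : ∀ i, (X i).IsGood) (hπ : Set.InjOn π Y.graph.vertexSet) {r : ℕ}
    (hr : ∀ i, r + (X i).card ≤ Y.card) :
    r + ∑ i, (min ((X i).leftVerts π).card ((X i).rightVerts π).card + ((X i).midVerts π).card) ≤
      2 * (coveredVerts X Y π).card + min (Y.leftVerts π).card (Y.rightVerts π).card + 2 := by
  classical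
  have hY := h.isGood hX
  obtain ⟨i₁, i₂, ⟨w₁, hw₁, hmin⟩, w₂, hw₂, hmax⟩ := h.union.exists_extreme hY π
  have hsub : ∀ {i z}, z ∈ (X i).verts → z ∈ Y.verts := fun {i z} hz =>
    hY.mem_verts.2 (h.union.mem_vertexSet ((hX i).mem_verts.1 hz))
  have hu : ∀ i, Y.source ∈ (X i).graph.vertexSet := fun i => h.source_eq i ▸ (X i).source_mem
  have hv : ∀ i, Y.sink ∈ (X i).graph.vertexSet := fun i => h.sink_eq i ▸ (X i).sink_mem
  have hdisj : ∀ i j, i ≠ j → ∀ z ∈ (X i).verts, π z ≠ π Y.source → π z ≠ π Y.sink →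
      z ∉ (X j).verts := by
    intro i j hij z hz h1 h2 hzj
    rcases h.vertex_disjoint i j hij z ((hX i).mem_verts.1 hz) ((hX j).mem_verts.1 hzj) with
      rfl | rfl
    exacts [h1 rfl, h2 rfl]
  have hAY : ∀ i, ∀ z ∈ (X i).leftVerts π, z ∈ Y.leftVerts π := by
    intro i z hz
    rw [TTG.mem_leftVerts, h.source_eq, h.sink_eq] at hz
    exact TTG.mem_leftVerts.2 ⟨hsub hz.1, hz.2⟩
  have hBY : ∀ i, ∀ z ∈ (X i).rightVerts π, z ∈ Y.rightVerts π := by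
    intro i z hz
    rw [TTG.mem_rightVerts, h.source_eq, h.sink_eq] at hz
    exact TTG.mem_rightVerts.2 ⟨hsub hz.1, hz.2⟩
  have hmidC : ∀ i, (X i).midVerts π ⊆ coveredVerts X Y π := by
    intro i z hz
    rw [TTG.mem_midVerts, h.source_eq, h.sink_eq] at hz
    -- Any second part contains both terminals and so covers the middle vertices of part `i`.
    obtain ⟨j, hj⟩ : ∃ j, i ≠ j := by
      have hm := h.two_le
      by_contra! hall
      have h0 := (hall ⟨0, by omega⟩).symm.trans (hall ⟨1, by omega⟩)
      simp at h0
    rw [mem_coveredVerts]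
    refine ⟨hsub hz.1, j, fun hzj => ?_, ?_⟩
    · exact hdisj i j hj z hz.1 (by omega) (by omega) ((hX j).mem_verts.2 hzj)
    · rcases hz.2 with hz | hz
      · exact ⟨⟨_, hu j, hz.1⟩, _, hv j, hz.2⟩
      · exact ⟨⟨_, hv j, hz.1⟩, _, hu j, hz.2⟩
  have hmidY : Y.midVerts π ⊆ coveredVerts X Y π := by
    intro z hz
    rw [TTG.mem_midVerts] at hz
    have hzY := hY.mem_verts.1 hz.1
    rw [h.union.vertexSet_eq] at hzY
    obtain ⟨i, hi⟩ := Set.mem_iUnion.1 hzY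
    refine hmidC i (TTG.mem_midVerts.2 ⟨(hX i).mem_verts.2 hi, ?_⟩)
    rw [h.source_eq, h.sink_eq]
    exact hz.2
  have key := add_sum_min_card_le (C := coveredVerts X Y π) (W := fun i => (X i).verts)
    (A := fun i => (X i).leftVerts π) (B := fun i => (X i).rightVerts π) (i₁ := i₁) (i₂ := i₂)
    (fun z hz => hY.mem_verts_cases hπ hz) (fun i => le_card_sdiff_verts (hX i) hY (hr i))
    (by
      intro z hz hzC
      rw [TTG.mem_leftVerts] at hz
      by_contra hzi
      rw [(hX i₁).mem_verts] at hzi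
      have h1 := hmin z (hY.mem_verts.1 hz.1)
      have h2 : π w₁ ≠ π z := fun he =>
        hzi (hπ (h.union.mem_vertexSet hw₁) (hY.mem_verts.1 hz.1) he ▸ hw₁)
      exact hzC (mem_coveredVerts.2 ⟨hz.1, i₁, hzi, ⟨w₁, hw₁, by omega⟩, _, hu i₁, hz.2.1⟩))
    (by
      intro z hz hzC
      rw [TTG.mem_rightVerts] at hz
      by_contra hzi
      rw [(hX i₂).mem_verts] at hzi
      have h1 := hmax z (hY.mem_verts.1 hz.1)
      have h2 : π w₂ ≠ π z := fun he =>
        hzi (hπ (h.union.mem_vertexSet hw₂) (hY.mem_verts.1 hz.1) he ▸ hw₂)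
      exact hzC (mem_coveredVerts.2 ⟨hz.1, i₂, hzi, ⟨_, hu i₂, hz.2.1⟩, w₂, hw₂, by omega⟩))
    (fun i z hz _ => hAY i z hz) (fun i z hz _ => hBY i z hz)
    (fun i j hij z hz => by
      rw [TTG.mem_leftVerts, h.source_eq, h.sink_eq] at hz
      exact hdisj i j hij z hz.1 (by omega) (by omega))
    (fun i j hij z hz => by
      rw [TTG.mem_rightVerts, h.source_eq, h.sink_eq] at hz
      exact hdisj i j hij z hz.1 (by omega) (by omega))
  rw [Finset.union_eq_left.2 hmidY] at key
  -- Nonterminal vertices lie in only one part, so all these sets are disjoint subsets of the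
  -- covered vertices. This is the second of the two copies of the covered vertices in the bound.
  have hsum : ∑ i, ((((X i).leftVerts π ∪ (X i).rightVerts π) ∩ coveredVerts X Y π).card +
      ((X i).midVerts π).card) ≤ (coveredVerts X Y π).card := by
    have hmem : ∀ i, ∀ z ∈ ((X i).leftVerts π ∪ (X i).rightVerts π) ∩ coveredVerts X Y π ∪
        (X i).midVerts π, z ∈ (X i).verts ∧ π z ≠ π Y.source ∧ π z ≠ π Y.sink := by
      intro i z hz
      simp only [Finset.mem_union, Finset.mem_inter, TTG.mem_leftVerts, TTG.mem_rightVerts,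
        TTG.mem_midVerts, h.source_eq, h.sink_eq] at hz
      rcases hz with ⟨h1 | h1, -⟩ | h1
      all_goals exact ⟨h1.1, by omega, by omega⟩
    have hcard : ∀ i, (((X i).leftVerts π ∪ (X i).rightVerts π) ∩ coveredVerts X Y π).card +
        ((X i).midVerts π).card = (((X i).leftVerts π ∪ (X i).rightVerts π) ∩ coveredVerts X Y π ∪
          (X i).midVerts π).card := by
      intro i
      rw [Finset.card_union_of_disjoint]
      rw [Finset.disjoint_left]
      intro z hz hz'
      simp only [Finset.mem_union, Finset.mem_inter, TTG.mem_leftVerts,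
        TTG.mem_rightVerts] at hz
      rw [TTG.mem_midVerts] at hz'
      omega
    simp only [hcard]
    refine sum_card_le_of_pairwise_disjoint (fun i j hij z hz hz' => ?_)
      fun i => Finset.union_subset Finset.inter_subset_right (hmidC i)
    obtain ⟨h1, h2, h3⟩ := hmem i z hz
    exact hdisj i j hij z h1 h2 h3 (hmem j z hz').1
  rw [Finset.sum_add_distrib] at hsum ⊢
  omega

/-! ### Lower bound: the potential at series compositions -/

namespace IsSeriesComposition

theorem eq_terminal_of_mem (h : IsSeriesComposition X Y) {i j : Fin m} (hij : i ≠ j)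
    (hi : z ∈ (X i).graph.vertexSet) (hj : z ∈ (X j).graph.vertexSet) :
    z = (X i).source ∨ z = (X i).sink := by
  rcases lt_or_gt_of_ne hij with hij | hij
  · exact Or.inr (h.vertex_disjoint i j hij z hi hj).2
  · obtain ⟨h1, h2⟩ := h.vertex_disjoint j i hij z hj hi
    exact Or.inl (h2.trans (h.sink_eq_source j i h1))

/-- Consecutive parts that do not contain an uncovered vertex `z` lie on the same side of `z`. -/
theorem lt_iff_lt_of_not_covers (h : IsSeriesComposition X Y)
    (hπ : Set.InjOn π Y.graph.vertexSet) (hz : z ∈ Y.graph.vertexSet)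
    (hcov : ∀ i, ¬ (X i).Covers π z) {i j : Fin m} (hij : i ≤ j)
    (hno : ∀ k, i ≤ k → k ≤ j → z ∉ (X k).graph.vertexSet) {p q : α}
    (hp : p ∈ (X i).graph.vertexSet) (hq : q ∈ (X j).graph.vertexSet) :
    π p < π z ↔ π q < π z := by
  -- A part that neither contains nor covers `z` lies on one side of it; the merged vertices carry
  -- this side from part to part.
  have hside : ∀ k, z ∉ (X k).graph.vertexSet → ∀ p ∈ (X k).graph.vertexSet,
      ∀ q ∈ (X k).graph.vertexSet, π p < π z → π q < π z := by
    intro k hk p hp q hq hpz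
    by_contra hqz
    have hne : π q ≠ π z := fun he => hk (hπ (h.union.mem_vertexSet hq) hz he ▸ hq)
    exact hcov k ⟨hk, ⟨p, hp, hpz⟩, q, hq, by omega⟩
  obtain ⟨j, hj⟩ := j
  induction j generalizing q with
  | zero =>
    obtain rfl : i = ⟨0, hj⟩ := le_antisymm hij (Fin.le_def.2 (Nat.zero_le _))
    have := hno _ le_rfl le_rfl
    exact ⟨hside _ this p hp q hq, hside _ this q hq p hp⟩
  | succ j ih =>
    rcases hij.eq_or_lt with rfl | hlt
    · have := hno _ le_rfl le_rfl
      exact ⟨hside _ this p hp q hq, hside _ this q hq p hp⟩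
    · have hs := h.sink_eq_source ⟨j, by omega⟩ ⟨j + 1, hj⟩ rfl
      have h1 := ih (q := (X ⟨j, by omega⟩).sink) (by omega)
        (Fin.le_def.2 (Nat.le_of_lt_succ (Fin.lt_def.1 hlt)))
        (fun k hk hk' => hno k hk (hk'.trans (Fin.le_def.2 (Nat.le_succ j)))) (X _).sink_mem
      have h2 := hno ⟨j + 1, hj⟩ hij le_rfl
      refine h1.trans ?_
      rw [hs]
      exact ⟨hside _ h2 _ (X _).source_mem q hq, hside _ h2 q hq _ (X _).source_mem⟩

/-- The vertex `z` lies in a part before or after part `j`. On the other side, all parts from `j` to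
that end of the chain avoid `z` and thus stay on one side of it. Hence an uncovered `z` left of both
terminals must lie in the part with the leftmost vertex, and likewise on the right. -/
theorem lt_iff_of_notMem (h : IsSeriesComposition X Y)
    (hπ : Set.InjOn π Y.graph.vertexSet) (hz : z ∈ Y.graph.vertexSet)
    (hcov : ∀ i, ¬ (X i).Covers π z) {j : Fin m} (hj : z ∉ (X j).graph.vertexSet) {w : α}
    (hw : w ∈ (X j).graph.vertexSet) :
    (π Y.source < π z ↔ π w < π z) ∨ (π w < π z ↔ π Y.sink < π z) := by
  have hm := h.two_le
  have hz' := hz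
  rw [h.union.vertexSet_eq] at hz'
  obtain ⟨i, hi⟩ := Set.mem_iUnion.1 hz'
  have hij : i ≠ j := by
    rintro rfl
    exact hj hi
  rcases lt_or_gt_of_ne hij with hij | hij
  · refine Or.inr (h.lt_iff_lt_of_not_covers (j := ⟨m - 1, by omega⟩) hπ hz hcov
      (Fin.le_def.2 (by dsimp only; omega)) (fun k hk _ hzk => ?_) hw
      (by rw [h.sink_eq ⟨m - 1, by omega⟩ (by dsimp only; omega)]; exact (X _).sink_mem))
    rcases hk.eq_or_lt with rfl | hk
    · exact hj hzk
    · have h1 := (h.vertex_disjoint i k (hij.trans hk) z hi hzk).1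
      rw [Fin.lt_def] at hij hk
      omega
  · refine Or.inl (h.lt_iff_lt_of_not_covers (i := ⟨0, by omega⟩) hπ hz hcov
      (Fin.le_def.2 (Nat.zero_le _)) (fun k _ hk hzk => ?_)
      (by rw [h.source_eq ⟨0, by omega⟩ rfl]; exact (X _).source_mem) hw)
    rcases hk.eq_or_lt with rfl | hk
    · exact hj hzk
    · have h1 := (h.vertex_disjoint k i (hk.trans hij) z hzk hi).1
      rw [Fin.lt_def] at hij hk
      omega

/-- The terminals of a part and of the whole lie on the same sides of an uncovered vertex. -/
theorem lt_iff_of_mem (h : IsSeriesComposition X Y)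
    (hπ : Set.InjOn π Y.graph.vertexSet) (hcov : ∀ i, ¬ (X i).Covers π z) {j : Fin m}
    (hj : z ∈ (X j).graph.vertexSet) (hs : z ≠ (X j).source) (ht : z ≠ (X j).sink) :
    (π Y.source < π z ↔ π (X j).source < π z) ∧ (π (X j).sink < π z ↔ π Y.sink < π z) := by
  have hm := h.two_le
  have hz := h.union.mem_vertexSet hj
  have hno : ∀ k, k ≠ j → z ∉ (X k).graph.vertexSet := fun k hk hzk =>
    (h.eq_terminal_of_mem hk.symm hj hzk).elim hs ht
  constructor
  · by_cases hj0 : (j : ℕ) = 0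
    · rw [h.source_eq j hj0]
    · rw [← h.sink_eq_source ⟨j - 1, by omega⟩ j (by dsimp only; omega)]
      refine h.lt_iff_lt_of_not_covers (i := ⟨0, by omega⟩) hπ hz hcov
        (Fin.le_def.2 (Nat.zero_le _)) (fun k _ hk => hno k ?_)
        (by rw [h.source_eq ⟨0, by omega⟩ rfl]; exact (X _).source_mem) (X _).sink_mem
      rintro rfl
      rw [Fin.le_def] at hk
      dsimp only at hk
      omega
  · by_cases hjm : (j : ℕ) + 1 = m
    · rw [h.sink_eq j hjm]
    · rw [h.sink_eq_source j ⟨j + 1, by omega⟩ rfl]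
      refine h.lt_iff_lt_of_not_covers (j := ⟨m - 1, by omega⟩) hπ hz hcov
        (Fin.le_def.2 (by dsimp only; omega)) (fun k hk _ => hno k ?_) (X _).source_mem
        (by rw [h.sink_eq ⟨m - 1, by omega⟩ (by dsimp only; omega)]; exact (X _).sink_mem)
      rintro rfl
      rw [Fin.le_def] at hk
      dsimp only at hk
      omega

/-- Here the middle vertices of the whole may be uncovered, so they remain in the bound and are
passed on to the parent. -/
theorem add_sum_min_le (h : IsSeriesComposition X Y)
    (hX : ∀ i, (X i).IsGood) (hπ : Set.InjOn π Y.graph.vertexSet) {r : ℕ}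
    (hr : ∀ i, r + (X i).card ≤ Y.card) :
    r + ∑ i, min ((X i).leftVerts π).card ((X i).rightVerts π).card ≤
      2 * (coveredVerts X Y π).card + min (Y.leftVerts π).card (Y.rightVerts π).card +
        (Y.midVerts π).card + 2 := by
  classical
  have hY := h.isGood hX
  obtain ⟨i₁, i₂, ⟨w₁, hw₁, hmin⟩, w₂, hw₂, hmax⟩ := h.union.exists_extreme hY π
  have hsub : ∀ {i z}, z ∈ (X i).verts → z ∈ Y.verts := fun {i z} hz =>
    hY.mem_verts.2 (h.union.mem_vertexSet ((hX i).mem_verts.1 hz))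
  have hC : ∀ {z}, z ∈ Y.verts → z ∉ coveredVerts X Y π → ∀ i, ¬ (X i).Covers π z :=
    fun hz hzC i hi => hzC (mem_coveredVerts.2 ⟨hz, i, hi⟩)
  have hdisj : ∀ i j, i ≠ j → ∀ z ∈ (X i).verts, π z ≠ π (X i).source → π z ≠ π (X i).sink →
      z ∉ (X j).verts := by
    intro i j hij z hz h1 h2 hzj
    rcases h.eq_terminal_of_mem hij ((hX i).mem_verts.1 hz) ((hX j).mem_verts.1 hzj) with rfl | rfl
    exacts [h1 rfl, h2 rfl]
  -- For uncovered vertices, left and right of the terminals of a part agree with left and right of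
  -- the terminals of the whole. For covered ones this may fail, which is why `add_sum_min_card_le`
  -- excludes them.
  have hsides : ∀ i, ∀ z ∈ (X i).verts, π z ≠ π (X i).source → π z ≠ π (X i).sink →
      z ∉ coveredVerts X Y π → (π Y.source < π z ↔ π (X i).source < π z) ∧
        (π (X i).sink < π z ↔ π Y.sink < π z) ∧ π z ≠ π Y.source ∧ π z ≠ π Y.sink := by
    intro i z hz h1 h2 hzC
    have hzi := (hX i).mem_verts.1 hz
    have hs : z ≠ (X i).source := by rintro rfl; exact h1 rfl
    have ht : z ≠ (X i).sink := by rintro rfl; exact h2 rfl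
    have h3 := h.lt_iff_of_mem hπ (hC (hsub hz) hzC) hzi hs ht
    have hm := h.two_le
    refine ⟨h3.1, h3.2, fun he => ?_, fun he => ?_⟩
    · have hz0 := hπ (h.union.mem_vertexSet hzi) Y.source_mem he
      by_cases hi : (i : ℕ) = 0
      · exact hs (hz0.trans (h.source_eq i hi))
      · exact h.source_notMem hi (hz0 ▸ hzi)
    · have hz0 := hπ (h.union.mem_vertexSet hzi) Y.sink_mem he
      have hlast := h.sink_eq ⟨m - 1, by omega⟩ (by dsimp only; omega)
      by_cases hi : i = ⟨m - 1, by omega⟩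
      · exact ht (hz0.trans (hlast.trans (by rw [hi])))
      · refine (h.eq_terminal_of_mem hi hzi ?_).elim hs ht
        rw [hz0, hlast]
        exact (X _).sink_mem
  have key := add_sum_min_card_le (C := coveredVerts X Y π) (W := fun i => (X i).verts)
    (A := fun i => (X i).leftVerts π) (B := fun i => (X i).rightVerts π) (i₁ := i₁) (i₂ := i₂)
    (fun z hz => hY.mem_verts_cases hπ hz) (fun i => le_card_sdiff_verts (hX i) hY (hr i))
    (by
      intro z hz hzC
      rw [TTG.mem_leftVerts] at hz
      by_contra hzi
      rw [(hX i₁).mem_verts] at hzi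
      have hzY := hY.mem_verts.1 hz.1
      have h1 := hmin z hzY
      have h2 : π w₁ ≠ π z := fun he => hzi (hπ (h.union.mem_vertexSet hw₁) hzY he ▸ hw₁)
      have h3 := h.lt_iff_of_notMem hπ hzY (hC hz.1 hzC) hzi hw₁
      omega)
    (by
      intro z hz hzC
      rw [TTG.mem_rightVerts] at hz
      by_contra hzi
      rw [(hX i₂).mem_verts] at hzi
      have hzY := hY.mem_verts.1 hz.1
      have h1 := hmax z hzY
      have h2 : π w₂ ≠ π z := fun he => hzi (hπ (h.union.mem_vertexSet hw₂) hzY he ▸ hw₂)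
      have h3 := h.lt_iff_of_notMem hπ hzY (hC hz.1 hzC) hzi hw₂
      omega)
    (fun i z hz hzC => by
      rw [TTG.mem_leftVerts] at hz ⊢
      have := hsides i z hz.1 (by omega) (by omega) hzC
      exact ⟨hsub hz.1, by omega, by omega⟩)
    (fun i z hz hzC => by
      rw [TTG.mem_rightVerts] at hz ⊢
      have := hsides i z hz.1 (by omega) (by omega) hzC
      exact ⟨hsub hz.1, by omega, by omega⟩)
    (fun i j hij z hz => by
      rw [TTG.mem_leftVerts] at hz
      exact hdisj i j hij z hz.1 (by omega) (by omega))
    (fun i j hij z hz => by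
      rw [TTG.mem_rightVerts] at hz
      exact hdisj i j hij z hz.1 (by omega) (by omega))
  have hsum : ∑ i, (((X i).leftVerts π ∪ (X i).rightVerts π) ∩ coveredVerts X Y π).card ≤
      (coveredVerts X Y π).card := by
    have hmem : ∀ i, ∀ z ∈ ((X i).leftVerts π ∪ (X i).rightVerts π) ∩ coveredVerts X Y π,
        z ∈ (X i).verts ∧ π z ≠ π (X i).source ∧ π z ≠ π (X i).sink := by
      intro i z hz
      simp only [Finset.mem_union, Finset.mem_inter, TTG.mem_leftVerts, TTG.mem_rightVerts] at hz
      rcases hz with ⟨h1 | h1, -⟩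
      all_goals exact ⟨h1.1, by omega, by omega⟩
    refine sum_card_le_of_pairwise_disjoint (fun i j hij z hz hz' => ?_)
      fun i => Finset.inter_subset_right
    obtain ⟨h1, h2, h3⟩ := hmem i z hz
    exact hdisj i j hij z h1 h2 h3 (hmem j z hz').1
  have hCM := Finset.card_union_le (coveredVerts X Y π) (Y.midVerts π)
  omega

end IsSeriesComposition

/-- The load is bounded by the number of crossings, up to terms that are linear in the size. -/
theorem SPTree.IsSPTree.load_le {T : SPTree α β} (hT : T.IsSPTree) (hmin : T.IsMinimal)
    {π : α → ℕ} (hπ : Set.InjOn π T.ttg.graph.vertexSet) :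
    T.load + 2 ≤ 2 * T.ttg.crossings π +
        min (T.ttg.leftVerts π).card (T.ttg.rightVerts π).card + (T.ttg.midVerts π).card +
          2 * T.ttg.edges.card ∧
      (¬ T.IsS → T.load + 2 ≤ 2 * T.ttg.crossings π +
        min (T.ttg.leftVerts π).card (T.ttg.rightVerts π).card + 2 * T.ttg.edges.card) := by
  induction T with
  | leaf k X =>
    obtain ⟨v, e, h⟩ := hT
    have hk : k ≠ 0 := by
      rintro rfl
      exact X.source_ne_sink (h.source_eq.trans h.sink_eq.symm)
    simp only [load, ttg, h.card_edges]
    omega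
  | @series X m c ih =>
    have hgood := fun i => (hT.2 i).isGood
    have hsub : ∀ i, Set.InjOn π (c i).ttg.graph.vertexSet := fun i =>
      hπ.mono fun x hx => hT.1.union.mem_vertexSet hx
    -- Minimality enters here: children of an S-node satisfy the stronger bound, without middle
    -- vertices.
    have hnS : ∀ i, ¬ (c i).IsS := by
      intro i hi
      have := hmin.1 i
      cases hci : c i <;> rw [hci] at hi this
      exacts [hi, this.elim id id, hi]
    have h1 := Finset.sum_le_sum fun i (_ : i ∈ Finset.univ) =>
      (ih i (hT.2 i) (hmin.2.2 i) (hsub i)).2 (hnS i)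
    simp only [Finset.sum_add_distrib, ← Finset.mul_sum, Finset.sum_const, Finset.card_univ,
      Fintype.card_fin, smul_eq_mul] at h1
    rw [← hT.1.union.card_edges hgood] at h1
    have hsup : ∀ i, (c i).ttg.card ≤ Finset.univ.sup fun i => (c i).ttg.card := fun i =>
      Finset.le_sup (f := fun i => (c i).ttg.card) (Finset.mem_univ i)
    have hsup' : (Finset.univ.sup fun i => (c i).ttg.card) ≤ X.card :=
      Finset.sup_le fun i _ => Set.ncard_le_ncard (fun x hx => hT.1.union.mem_vertexSet hx)
        (hT.1.union.finite_verts hgood)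
    have h2 := hT.1.add_sum_min_le hgood hπ
      (r := X.card - Finset.univ.sup fun i => (c i).ttg.card)
      (fun i => by have := hsup i; omega)
    have h3 := hT.1.union.sum_crossings_add_le hgood (hT.1.isGood hgood) hπ
    -- The summand 2 in the induction hypothesis yields 2m ≥ 4 over the children. This pays for the
    -- 2 in `h2` and for the 2 in the claim.
    have hm := hT.1.two_le
    refine ⟨?_, fun h => (h trivial).elim⟩
    simp only [load, ttg] at *
    omega
  | @parallel X m c ih =>
    have hgood := fun i => (hT.2 i).isGood
    have hsub : ∀ i, Set.InjOn π (c i).ttg.graph.vertexSet := fun i =>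
      hπ.mono fun x hx => hT.1.union.mem_vertexSet hx
    -- Children of a P-node may be S-nodes, so only the weaker bound is used; `h2` absorbs their
    -- middle vertices.
    have h1 := Finset.sum_le_sum fun i (_ : i ∈ Finset.univ) =>
      (ih i (hT.2 i) (hmin.2 i) (hsub i)).1
    simp only [Finset.sum_add_distrib, ← Finset.mul_sum, Finset.sum_const, Finset.card_univ,
      Fintype.card_fin, smul_eq_mul] at h1
    rw [← hT.1.union.card_edges hgood] at h1
    have hsup : ∀ i, (c i).ttg.card ≤ Finset.univ.sup fun i => (c i).ttg.card := fun i =>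
      Finset.le_sup (f := fun i => (c i).ttg.card) (Finset.mem_univ i)
    have hsup' : (Finset.univ.sup fun i => (c i).ttg.card) ≤ X.card :=
      Finset.sup_le fun i _ => Set.ncard_le_ncard (fun x hx => hT.1.union.mem_vertexSet hx)
        (hT.1.union.finite_verts hgood)
    have h2 := hT.1.add_sum_min_le hgood hπ
      (r := X.card - Finset.univ.sup fun i => (c i).ttg.card)
      (fun i => by have := hsup i; omega)
    rw [Finset.sum_add_distrib] at h2
    have h3 := hT.1.union.sum_crossings_add_le hgood (hT.1.isGood hgood) hπ
    have hm := hT.1.two_le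
    simp only [load, ttg] at *
    omega

end Potential

/-! ### The approximation ratio -/

theorem TTG.IsGood.cost_eq {X : TTG α β} (hX : X.IsGood) (π : α → ℕ) :
    cost X.graph π = ∑ e ∈ X.edges, edgeLength X.graph π e := by
  have : X.graph.edgeSet = (X.edges : Set β) := by
    ext e
    rw [Finset.mem_coe, hX.mem_edges]
  rw [cost, this, finsum_mem_coe_finset]

/-- For `w` outside the graph the degree is 0, so no membership is needed. -/
theorem TTG.IsGood.deg_le_maxDegree {X : TTG α β} (hX : X.IsGood) (w : α) :
    X.deg w ≤ maxDegree X.graph := by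
  classical
  have hdeg : X.deg w = (X.graph.incidenceSet w).ncard := by
    have : X.graph.incidenceSet w = (X.edges.filter fun e => X.graph.Inc e w : Finset β) := by
      ext e
      simp only [Graph.mem_incidenceSet, Finset.coe_filter, Set.mem_ofPred_eq, hX.mem_edges]
      exact ⟨fun h => ⟨h.edge_mem, h⟩, And.right⟩
    rw [this, Set.ncard_coe_finset, Finset.card_filter, TTG.deg]
  by_cases hw : w ∈ X.graph.vertexSet
  · rw [hdeg]
    exact le_csSup (hX.finite_verts.image _).bddAbove ⟨w, hw, rfl⟩
  · rw [TTG.deg, Finset.sum_eq_zero]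
    · exact Nat.zero_le _
    · exact fun e _ => if_neg fun h => hw h.vertex_mem

theorem TTG.IsGood.maxDegree_pos {X : TTG α β} (hX : X.IsGood) (h : 0 < X.edges.card) :
    0 < maxDegree X.graph := by
  obtain ⟨e, he⟩ := Finset.card_pos.1 h
  obtain ⟨x, y, hxy⟩ := Graph.exists_isLink_of_mem_edgeSet (hX.mem_edges.1 he)
  refine lt_of_lt_of_le ?_ (hX.deg_le_maxDegree x)
  classical
  refine Finset.sum_pos' (fun _ _ => Nat.zero_le _) ⟨e, he, ?_⟩
  rw [if_pos hxy.inc_left]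
  exact one_pos

theorem SPGAA.cost_le [DecidableEq α] {T : SPTree α β} {l : List α} (h : SPGAA T l)
    (hT : T.IsSPTree) (hmin : T.IsMinimal) {π : α → ℕ}
    (hπ : IsLinearArrangement T.ttg.graph π) :
    cost T.ttg.graph (position l) ≤
      14 * maxDegree T.ttg.graph ^ 2 * cost T.ttg.graph π := by
  have hX := hT.isGood
  rw [hX.cost_eq, hX.cost_eq]
  have h1 := h.sum_edgeLength_le hT hX.deg_le_maxDegree
  have h2 := hX.card_edges_add_crossings_le hπ.injOn
  have h3 := (hT.load_le hmin hπ.injOn).1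
  have h4 := hX.min_add_card_midVerts_le (π := π)
  have h5 := hT.card_le
  have h6 := TTG.two_le_card hX
  have hD := hX.maxDegree_pos (by omega)
  refine h1.trans ?_
  set D := maxDegree T.ttg.graph
  set O := ∑ e ∈ T.ttg.edges, edgeLength T.ttg.graph π e
  -- The load is at most twice the crossings plus 2|E| plus |V| - 4, and |V| ≤ |E| + 1; edges plus
  -- crossings are at most `O`.
  have h7 : T.load ≤ 3 * O := by omega
  have h8 : T.ttg.edges.card ≤ O := by omega
  calc 2 * T.ttg.edges.card + 4 * D * T.load ≤ 2 * O + 4 * D * (3 * O) :=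
        Nat.add_le_add (Nat.mul_le_mul_left _ h8) (Nat.mul_le_mul_left _ h7)
    _ ≤ 14 * D ^ 2 * O := by
        -- Uses D ≥ 1.
        have h9 : 2 + 12 * D ≤ 14 * D ^ 2 := by nlinarith
        calc 2 * O + 4 * D * (3 * O) = (2 + 12 * D) * O := by ring
          _ ≤ _ := Nat.mul_le_mul_right O h9

end SPG

theorem mainTheorem1 {α β : Type*} [DecidableEq α] (G : Graph α β)
    (hG : SPG.IsSeriesParallel G) :
    (∃ T : SPG.SPTree α β, T.IsMinimalSPTreeOf G) ∧
    ∀ T : SPG.SPTree α β, T.IsMinimalSPTreeOf G →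
      (∃ l : List α, SPG.SPGAA T l) ∧
      ∀ l : List α, SPG.SPGAA T l →
        SPG.IsLinearArrangement G (SPG.position l) ∧
        ∀ πOpt : α → ℕ, SPG.IsOptimalArrangement G πOpt →
          SPG.cost G (SPG.position l) ≤ 14 * SPG.maxDegree G ^ 2 * SPG.cost G πOpt := by
  constructor
  · obtain ⟨X, rfl, hX⟩ := hG
    obtain ⟨T, rfl, hT, hmin⟩ := hX.exists_minimal_spTree
    exact ⟨T, rfl, hT, hmin⟩
  · rintro T ⟨rfl, hT, hmin⟩
    exact ⟨hT.exists_arrangement, fun l hl => ⟨(hl.enumerates hT).isLinearArrangement,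
      fun π hπ => hl.cost_le hT hmin hπ.1⟩⟩
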